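/- Notation. Let $\mu$ be the Möbius function and $M(x)=\sum_{n\le x}\mu(n)$ for real $x$. Let $K:[0,1]\times[0,1]\to\mathbb R$ be the symmetric kernel with $K(x,y)=\frac12-\left\{\frac1{xy}\right\}$ for $0<x,y\le 1$, where $\{\alpha\}=\alpha-\lfloor\alpha\rfloor$, and $K(x,y)=0$ if $xy=0$. An eigenvalue of $K$ is a number $\lambda$ for which there is an eigenfunction, that is, a measurable $\phi$ on $[0,1]$ with $0<\int_0^1\phi(x)^2\,dx<\infty$ and $\phi(x)=\lambda\int_0^1K(x,y)\phi(y)\,dy$ for all $x\in[0,1]$; its index is the dimension of the space spanned by these eigenfunctions. Let $\lambda_{1+}\le\lambda_{2+}\le\cdots$ be the positive eigenvalues and $\lambda_{1-}\ge\lambda_{2-}\ge\cdots$ the negative eigenvalues of $K$, each repeated according to its index, and put $\nu_{j\pm}=1/\lambda_{j\pm}$ (and $\nu_{j\pm}=0$ if there are fewer than $j$ eigenvalues of that sign). Let $\phi_{j\pm}$ be real eigenfunctions of $K$ belonging to the eigenvalues $\lambda_{j\pm}$, chosen so that all of them together form an orthonormal system for $\langle\alpha,\beta\rangle=\int_0^1\alpha(x)\beta(x)\,dx$.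 Theorem 3. There is an absolute constant $C$ such that, for every such choice of the $\phi_{j\pm}$, every integer $N\ge1$ and every real $\delta>\sqrt{\frac{1+\log N}{N}}$, there are only finitely many $j\ge 1$ with $|\nu_{j-}|>\delta$ and only finitely many with $\nu_{j+}>\delta$, and $$M(N^2)=\sum_{j:\,|\nu_{j-}|>\delta}\Bigl(\sum_{n=1}^N\mu(n)\,\phi_{j-}\bigl(\tfrac nN\bigr)\Bigr)^{2}|\nu_{j-}|-\sum_{j:\,\nu_{j+}>\delta}\Bigl(\sum_{n=1}^N\mu(n)\,\phi_{j+}\bigl(\tfrac nN\bigr)\Bigr)^{2}\nu_{j+}+\frac{M(N)^2}{2}-\Bigl(\sum_{n=1}^N\frac{\mu(n)}n\Bigr)^{2}N^2+R$$ with $|R|\le C\,\delta N^2$. -/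

import Mathlib

open MeasureTheory

/-- Mertens' function `M(x) = ∑_{n ≤ x} μ(n)` of a real variable. -/
noncomputable def mertens (x : ℝ) : ℝ :=
  ∑ n ∈ Finset.Icc 1 ⌊x⌋₊, (ArithmeticFunction.moebius n : ℝ)

/-- The kernel `K(x,y) = 1/2 - {1/(xy)}` for `0 < x, y ≤ 1`, with `K(x,y) = 0` when `xy = 0`. -/
noncomputable def mertensKernel (x y : unitInterval) : ℝ :=
  if 0 < (x : ℝ) ∧ 0 < (y : ℝ) then 1 / 2 - Int.fract (1 / ((x : ℝ) * (y : ℝ))) else 0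

/-- `φ` is a (real, square integrable, non-null) eigenfunction of the kernel `K` on
`[0,1] × [0,1]`, with eigenvalue `l`: `φ(x) = l ∫₀¹ K(x,y) φ(y) dy` for all `x ∈ [0,1]`.
The eigenvalue multiplies the integral, so it is the reciprocal of an eigenvalue of the integral
operator. -/
structure IsKernelEigenfunction (K : unitInterval → unitInterval → ℝ) (l : ℝ)
    (φ : unitInterval → ℝ) : Prop where
  memLp : MemLp φ 2 volume
  norm_pos : 0 < ∫ x, φ x ^ 2
  eq : ∀ x, φ x = l * ∫ y, K x y * φ y

/-- The index (multiplicity) of `l`: the dimension of the space spanned by the eigenfunctions of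
`K` with eigenvalue `l` (it is `0` when `l` is not an eigenvalue). -/
noncomputable def kernelIndex (K : unitInterval → unitInterval → ℝ) (l : ℝ) : ℕ :=
  Module.finrank ℝ (Submodule.span ℝ {φ : unitInterval → ℝ | IsKernelEigenfunction K l φ})

/-- The reciprocal positive eigenvalues of `K`, counted with index, in decreasing order, numbered
from `0`: `recipPosEigenvalue K k` is the largest `t > 0` such that there are more than `k`
positive eigenvalues `l` with `1 / l ≥ t`, each counted as often as its index says; it is `0` if
`K` has at most `k` positive eigenvalues. -/
noncomputable def recipPosEigenvalue (K : unitInterval → unitInterval → ℝ) (k : ℕ) : ℝ :=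
  sSup {t : ℝ | 0 < t ∧ ∃ S : Finset ℝ,
    (∀ l ∈ S, 0 < l ∧ t ≤ 1 / l) ∧ k < ∑ l ∈ S, kernelIndex K l}

/-- The reciprocal negative eigenvalues of `K`, counted with index, in increasing order, numbered
from `0`: `recipNegEigenvalue K k` is the smallest `t < 0` such that there are more than `k`
negative eigenvalues `l` with `1 / l ≤ t`, each counted as often as its index says; it is `0` if
`K` has at most `k` negative eigenvalues. -/
noncomputable def recipNegEigenvalue (K : unitInterval → unitInterval → ℝ) (k : ℕ) : ℝ :=
  sInf {t : ℝ | t < 0 ∧ ∃ S : Finset ℝ,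
    (∀ l ∈ S, l < 0 ∧ 1 / l ≤ t) ∧ k < ∑ l ∈ S, kernelIndex K l}

/-- `φp` and `φm` are sequences of eigenfunctions of `K` belonging to its positive and to its
negative eigenvalues, in the order of `recipPosEigenvalue` and `recipNegEigenvalue`, which
together form an orthonormal system. The functions whose number exceeds the number of positive
(respectively negative) eigenvalues are arbitrary. -/
structure IsOrthonormalEigensystem (K : unitInterval → unitInterval → ℝ)
    (φp φm : ℕ → unitInterval → ℝ) : Prop where
  eigen_pos : ∀ j, recipPosEigenvalue K j ≠ 0 →
    IsKernelEigenfunction K (1 / recipPosEigenvalue K j) (φp j)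
  eigen_neg : ∀ j, recipNegEigenvalue K j ≠ 0 →
    IsKernelEigenfunction K (1 / recipNegEigenvalue K j) (φm j)
  orthonormal_pos : ∀ i j, recipPosEigenvalue K i ≠ 0 → recipPosEigenvalue K j ≠ 0 →
    ∫ x, φp i x * φp j x = if i = j then 1 else 0
  orthonormal_neg : ∀ i j, recipNegEigenvalue K i ≠ 0 → recipNegEigenvalue K j ≠ 0 →
    ∫ x, φm i x * φm j x = if i = j then 1 else 0
  orthogonal : ∀ i j, recipPosEigenvalue K i ≠ 0 → recipNegEigenvalue K j ≠ 0 →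
    ∫ x, φp i x * φm j x = 0

/-- The point `n / N` of `[0,1]`, for `n ≤ N` (used only for `1 ≤ n ≤ N`). -/
noncomputable def gridPoint (N n : ℕ) : unitInterval :=
  Set.projIcc 0 1 zero_le_one ((n : ℝ) / (N : ℝ))

theorem coe_gridPoint {N n : ℕ} (h : n ≤ N) : (gridPoint N n : ℝ) = (n : ℝ) / (N : ℝ) := by
  have h1 : (n : ℝ) / (N : ℝ) ≤ 1 :=
    div_le_one_of_le₀ (by exact_mod_cast h) (Nat.cast_nonneg N)
  have h0 : (0 : ℝ) ≤ (n : ℝ) / (N : ℝ) := by positivity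
  unfold gridPoint
  rw [Set.projIcc_of_mem zero_le_one ⟨h0, h1⟩]

/-- The sum `∑_{n=1}^N μ(n) φ(n/N)`. -/
noncomputable def moebiusSum (N : ℕ) (φ : unitInterval → ℝ) : ℝ :=
  ∑ n ∈ Finset.Icc 1 N, (ArithmeticFunction.moebius n : ℝ) * φ (gridPoint N n)

/-! Meissel's identity (`sum_moebius_sq`) writes M(N²) as 2M(N) minus the double sum of
μ(m)μ(n)⌊N²/(mn)⌋ over m, n ≤ N. Each floor is N²/(mn) − 1/2 plus the kernel at (m/N, n/N). The
first two pieces give the explicit terms (Σ μ(n)/n)²N² and M(N)²/2, and there remains a quadratic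
form in μ with matrix K(m/N, n/N) (`mertens_sq_eq`).

Let T be the integral operator of K and c the step function with value μ(n) on ((n−1)/N, n/N]. The
form is N² times ⟨c, Tc⟩ with both arguments of K rounded up to the grid. For fixed y, K is a
difference of two monotone functions of x up to a constant, so rounding x costs on average at most
min(1, 3/√(Ny)) (`integral_abs_mertensKernel_sub_le`). The L² norm of this bound is at most 3√((1 +
log N)/N), which explains the lower limit for δ.

T is symmetric and is a norm limit of finite rank operators, hence compact. Discarding the
eigenvalues of modulus at most δ therefore changes ⟨c, Tc⟩ by at most δ‖c‖² ≤ δ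
(`abs_inner_sub_sum_eigenvectors_le`). This needs the given eigenfunctions beyond δ to exhaust the
eigenspaces, which follows by comparing their number with the sum of the indices
(`eq_zero_of_orthogonal_eigenvectors`).

Finally, the eigenfunction equation turns the sampled sum (1/N) Σ μ(n)φ(n/N) into ⟨φ, c⟩ + ⟨φ, e⟩/ν,
with e the rounding error (`mul_moebiusSum_eq`). As |ν| > δ, Bessel's inequality for c and for e
bounds the total effect of this replacement by a multiple of δ. -/

/-- The space of square integrable functions on the unit interval. -/
abbrev UnitL2 : Type := Lp ℝ 2 (volume : Measure unitInterval)

theorem inner_toLp_toLp {f g : unitInterval → ℝ} (hf : MemLp f 2 volume) (hg : MemLp g 2 volume) :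
    inner ℝ (hf.toLp f) (hg.toLp g) = ∫ x, f x * g x := by
  rw [L2.inner_def]
  apply integral_congr_ae
  filter_upwards [hf.coeFn_toLp, hg.coeFn_toLp] with x h1 h2
  simp [h1, h2, mul_comm]

theorem norm_toLp_sq {f : unitInterval → ℝ} (hf : MemLp f 2 volume) :
    ‖hf.toLp f‖ ^ 2 = ∫ x, f x ^ 2 := by
  rw [← real_inner_self_eq_norm_sq, inner_toLp_toLp]
  simp only [pow_two]

theorem norm_sq_eq_integral (f : UnitL2) : ‖f‖ ^ 2 = ∫ x, f x ^ 2 := by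
  have h := norm_toLp_sq (Lp.memLp f)
  rwa [Lp.toLp_coeFn] at h

theorem sq_integral_mul_le {f g : unitInterval → ℝ} (hf : MemLp f 2 volume)
    (hg : MemLp g 2 volume) : (∫ x, f x * g x) ^ 2 ≤ (∫ x, f x ^ 2) * ∫ x, g x ^ 2 := by
  rw [← inner_toLp_toLp hf hg, ← norm_toLp_sq hf, ← norm_toLp_sq hg, ← mul_pow]
  exact sq_le_sq' (by linarith [neg_le_of_abs_le (abs_real_inner_le_norm (hf.toLp f) (hg.toLp g))])
    (real_inner_le_norm _ _)

theorem memLp_of_measurable_of_bound {f : unitInterval → ℝ} (hf : Measurable f) {C : ℝ}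
    (hC : ∀ x, |f x| ≤ C) {p : ENNReal} : MemLp f p volume :=
  MemLp.of_bound hf.aestronglyMeasurable C (Filter.Eventually.of_forall hC)

theorem integrable_of_measurable_of_bound {f : unitInterval → ℝ} (hf : Measurable f) {C : ℝ}
    (hC : ∀ x, |f x| ≤ C) : Integrable f volume :=
  (memLp_of_measurable_of_bound hf hC (p := 1)).integrable le_rfl

/-! ### Integral operators with bounded measurable kernels -/

/-- A measurable kernel on the unit square that is bounded by `C`. -/
structure IsBoundedKernel (k : unitInterval → unitInterval → ℝ) (C : ℝ) : Prop where
  measurable : Measurable (Function.uncurry k)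
  bound : ∀ x y, |k x y| ≤ C

namespace IsBoundedKernel

variable {k k' : unitInterval → unitInterval → ℝ} {C C' : ℝ}

theorem measurable_right (hk : IsBoundedKernel k C) (x : unitInterval) : Measurable (k x) :=
  hk.measurable.comp measurable_prodMk_left

theorem measurable_left (hk : IsBoundedKernel k C) (y : unitInterval) :
    Measurable fun x => k x y :=
  hk.measurable.comp measurable_prodMk_right

theorem neg (hk : IsBoundedKernel k C) : IsBoundedKernel (fun x y => -k x y) C :=
  ⟨hk.measurable.neg, fun x y => by simpa using hk.bound x y⟩

theorem sub (hk : IsBoundedKernel k C) (hk' : IsBoundedKernel k' C') :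
    IsBoundedKernel (fun x y => k x y - k' x y) (C + C') :=
  ⟨hk.measurable.sub hk'.measurable,
    fun x y => (abs_sub _ _).trans (add_le_add (hk.bound x y) (hk'.bound x y))⟩

theorem comp_left (hk : IsBoundedKernel k C) {g : unitInterval → unitInterval}
    (hg : Measurable g) : IsBoundedKernel (fun x y => k (g x) y) C :=
  ⟨hk.measurable.comp ((hg.comp measurable_fst).prodMk measurable_snd), fun _ _ => hk.bound _ _⟩

theorem swap (hk : IsBoundedKernel k C) : IsBoundedKernel (fun x y => k y x) C :=
  ⟨hk.measurable.comp measurable_swap, fun _ _ => hk.bound _ _⟩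

theorem memLp_right (hk : IsBoundedKernel k C) (x : unitInterval) : MemLp (k x) 2 volume :=
  memLp_of_measurable_of_bound (hk.measurable_right x) (hk.bound x)

theorem nonneg (hk : IsBoundedKernel k C) : 0 ≤ C := (abs_nonneg _).trans (hk.bound 0 0)

theorem integrable_mul (hk : IsBoundedKernel k C) {φ : unitInterval → ℝ}
    (hφ : Integrable φ volume) (x : unitInterval) : Integrable (fun y => k x y * φ y) volume :=
  hφ.bdd_mul (hk.measurable_right x).aestronglyMeasurable (Filter.Eventually.of_forall (hk.bound x))

theorem integrable_prod (hk : IsBoundedKernel k C) {φ ψ : unitInterval → ℝ}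
    (hφ : Integrable φ volume) (hψ : Integrable ψ volume) :
    Integrable (Function.uncurry fun x y => k x y * (ψ x * φ y)) (volume.prod volume) :=
  (hψ.mul_prod hφ).bdd_mul hk.measurable.aestronglyMeasurable
    (Filter.Eventually.of_forall fun z => hk.bound z.1 z.2)

theorem sq_integral_mul_le (hk : IsBoundedKernel k C) {φ : unitInterval → ℝ}
    (hφ : MemLp φ 2 volume) (x : unitInterval) :
    (∫ y, k x y * φ y) ^ 2 ≤ (∫ y, k x y ^ 2) * ∫ y, φ y ^ 2 :=
  _root_.sq_integral_mul_le (hk.memLp_right x) hφ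

theorem integral_sq_le (hk : IsBoundedKernel k C) (x : unitInterval) :
    ∫ y, k x y ^ 2 ≤ C ^ 2 := by
  calc ∫ y, k x y ^ 2 ≤ ∫ _y : unitInterval, C ^ 2 := by
        refine integral_mono (hk.memLp_right x).integrable_sq (integrable_const _) fun y => ?_
        exact sq_le_sq.2 ((hk.bound x y).trans (le_abs_self C))
    _ = C ^ 2 := by simp

theorem memLp_integral (hk : IsBoundedKernel k C) {φ : unitInterval → ℝ}
    (hφ : MemLp φ 2 volume) : MemLp (fun x => ∫ y, k x y * φ y) 2 volume := by
  have hm : AEStronglyMeasurable (fun x => ∫ y, k x y * φ y) volume := by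
    have h : AEStronglyMeasurable
        (fun z : unitInterval × unitInterval => k z.1 z.2 * φ z.2) (volume.prod volume) :=
      hk.measurable.aestronglyMeasurable.mul hφ.aestronglyMeasurable.comp_snd
    exact h.integral_prod_right'
  refine MemLp.of_bound hm (C * √(∫ y, φ y ^ 2)) (Filter.Eventually.of_forall fun x => ?_)
  rw [Real.norm_eq_abs]
  have h0 : 0 ≤ ∫ y, φ y ^ 2 := integral_nonneg fun _ => sq_nonneg _
  refine abs_le_of_sq_le_sq ?_ (mul_nonneg hk.nonneg (Real.sqrt_nonneg _))
  rw [mul_pow, Real.sq_sqrt h0]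
  exact (hk.sq_integral_mul_le hφ x).trans (mul_le_mul_of_nonneg_right (hk.integral_sq_le x) h0)

theorem integrable_integral_sq (hk : IsBoundedKernel k C) :
    Integrable (fun x => ∫ y, k x y ^ 2) volume := by
  have h : StronglyMeasurable (fun z : unitInterval × unitInterval => k z.1 z.2 ^ 2) :=
    (hk.measurable.pow_const 2).stronglyMeasurable
  refine integrable_of_measurable_of_bound h.integral_prod_right'.measurable (C := C ^ 2)
    fun x => ?_
  rw [abs_of_nonneg (integral_nonneg fun _ => sq_nonneg _)]
  exact hk.integral_sq_le x

/-- Cauchy–Schwarz in y for each x, then integration over x: the Hilbert–Schmidt norm of the kernel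
bounds the operator. -/
theorem integral_sq_integral_le (hk : IsBoundedKernel k C) {φ : unitInterval → ℝ}
    (hφ : MemLp φ 2 volume) :
    ∫ x, (∫ y, k x y * φ y) ^ 2 ≤ (∫ x, ∫ y, k x y ^ 2) * ∫ y, φ y ^ 2 := by
  rw [← integral_mul_const]
  exact integral_mono (hk.memLp_integral hφ).integrable_sq
    (hk.integrable_integral_sq.mul_const _) fun x => hk.sq_integral_mul_le hφ x

theorem integral_integral_sq_le (hk : IsBoundedKernel k C) : ∫ x, ∫ y, k x y ^ 2 ≤ C ^ 2 := by
  calc ∫ x, ∫ y, k x y ^ 2 ≤ ∫ _x : unitInterval, C ^ 2 :=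
        integral_mono hk.integrable_integral_sq (integrable_const _) hk.integral_sq_le
    _ = C ^ 2 := by simp

end IsBoundedKernel

/-- The integral operator on `L²[0,1]` of a bounded measurable kernel. -/
noncomputable def kernelOp {k : unitInterval → unitInterval → ℝ} {C : ℝ}
    (hk : IsBoundedKernel k C) : UnitL2 →L[ℝ] UnitL2 :=
  LinearMap.mkContinuous
    { toFun := fun f => (hk.memLp_integral (Lp.memLp f)).toLp _
      map_add' := fun f g => by
        rw [← MemLp.toLp_add]
        refine MemLp.toLp_congr _ _ (Filter.Eventually.of_forall fun x => ?_)
        have hf := hk.integrable_mul ((Lp.memLp f).integrable one_le_two) x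
        have hg := hk.integrable_mul ((Lp.memLp g).integrable one_le_two) x
        rw [Pi.add_apply, ← integral_add hf hg]
        apply integral_congr_ae
        filter_upwards [Lp.coeFn_add f g] with y hy
        rw [hy, Pi.add_apply, mul_add]
      map_smul' := fun c f => by
        rw [RingHom.id_apply, ← MemLp.toLp_const_smul]
        refine MemLp.toLp_congr _ _ (Filter.Eventually.of_forall fun x => ?_)
        rw [Pi.smul_apply, smul_eq_mul, ← integral_const_mul]
        apply integral_congr_ae
        filter_upwards [Lp.coeFn_smul c f] with y hy
        rw [hy, Pi.smul_apply, smul_eq_mul]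
        ring }
    C fun f => by
      refine le_of_sq_le_sq ?_ (mul_nonneg hk.nonneg (norm_nonneg f))
      rw [LinearMap.coe_mk, AddHom.coe_mk, norm_toLp_sq, mul_pow, norm_sq_eq_integral]
      exact (hk.integral_sq_integral_le (Lp.memLp f)).trans
        (mul_le_mul_of_nonneg_right hk.integral_integral_sq_le (integral_nonneg fun _ => sq_nonneg _))

section kernelOp

variable {k k' : unitInterval → unitInterval → ℝ} {C C' : ℝ}

theorem kernelOp_apply (hk : IsBoundedKernel k C) (f : UnitL2) :
    kernelOp hk f = (hk.memLp_integral (Lp.memLp f)).toLp _ := rfl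

theorem integral_kernel_congr {f g : unitInterval → ℝ} (h : f =ᵐ[volume] g) (x : unitInterval) :
    ∫ y, k x y * f y = ∫ y, k x y * g y :=
  integral_congr_ae (by filter_upwards [h] with y hy; rw [hy])

theorem kernelOp_toLp (hk : IsBoundedKernel k C) {φ : unitInterval → ℝ} (hφ : MemLp φ 2 volume) :
    kernelOp hk (hφ.toLp φ) = (hk.memLp_integral hφ).toLp _ := by
  rw [kernelOp_apply]
  exact MemLp.toLp_congr _ _
    (Filter.Eventually.of_forall fun x => integral_kernel_congr hφ.coeFn_toLp x)

theorem inner_toLp_kernelOp_toLp (hk : IsBoundedKernel k C) {φ ψ : unitInterval → ℝ}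
    (hφ : MemLp φ 2 volume) (hψ : MemLp ψ 2 volume) :
    inner ℝ (hψ.toLp ψ) (kernelOp hk (hφ.toLp φ)) = ∫ x, ∫ y, k x y * (ψ x * φ y) := by
  rw [kernelOp_toLp, inner_toLp_toLp]
  congr 1 with x
  rw [← integral_const_mul]
  congr 1 with y
  ring

theorem isSymmetric_kernelOp (hk : IsBoundedKernel k C) (hs : ∀ x y, k x y = k y x) :
    (kernelOp hk).IsSymmetric := by
  intro f g
  obtain ⟨φ, hφ, rfl⟩ : ∃ φ, ∃ hφ : MemLp φ 2 volume, f = hφ.toLp φ :=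
    ⟨f, Lp.memLp f, (Lp.toLp_coeFn f _).symm⟩
  obtain ⟨ψ, hψ, rfl⟩ : ∃ φ, ∃ hφ : MemLp φ 2 volume, g = hφ.toLp φ :=
    ⟨g, Lp.memLp g, (Lp.toLp_coeFn g _).symm⟩
  change inner ℝ (kernelOp hk _) _ = inner ℝ _ (kernelOp hk _)
  rw [real_inner_comm, inner_toLp_kernelOp_toLp hk hφ hψ, inner_toLp_kernelOp_toLp hk hψ hφ,
    integral_integral_swap
      (hk.integrable_prod (hφ.integrable one_le_two) (hψ.integrable one_le_two))]
  congr 1 with x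
  congr 1 with y
  rw [hs y x, mul_comm (ψ y)]

/-- Kernels close in the L² norm of the square give operators close in norm; this is how compactness
passes to a limit of kernels. -/
theorem norm_kernelOp_sub_le (hk : IsBoundedKernel k C) (hk' : IsBoundedKernel k' C') :
    ‖kernelOp hk - kernelOp hk'‖ ≤ √(∫ x, ∫ y, (k x y - k' x y) ^ 2) := by
  refine ContinuousLinearMap.opNorm_le_bound _ (Real.sqrt_nonneg _) fun f => ?_
  have h0 : 0 ≤ ∫ x, ∫ y, (k x y - k' x y) ^ 2 :=
    integral_nonneg fun _ => integral_nonneg fun _ => sq_nonneg _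
  refine le_of_sq_le_sq ?_ (mul_nonneg (Real.sqrt_nonneg _) (norm_nonneg f))
  have h1 : (kernelOp hk - kernelOp hk') f = kernelOp (hk.sub hk') f := by
    rw [_root_.sub_apply, kernelOp_apply, kernelOp_apply, kernelOp_apply,
      ← MemLp.toLp_sub]
    refine MemLp.toLp_congr _ _ (Filter.Eventually.of_forall fun x => ?_)
    have hf := (Lp.memLp f).integrable one_le_two
    simp only [Pi.sub_apply]
    rw [← integral_sub (hk.integrable_mul hf x) (hk'.integrable_mul hf x)]
    congr 1 with y
    ring
  rw [h1, kernelOp_apply, norm_toLp_sq, mul_pow, norm_sq_eq_integral, Real.sq_sqrt h0]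
  exact (hk.sub hk').integral_sq_integral_le (Lp.memLp f)

/-- If the sections of the kernel take only finitely many values then the operator has finite
rank, hence is compact. -/
theorem isCompactOperator_kernelOp_of_factor (hk : IsBoundedKernel k C) {n : ℕ}
    {g : unitInterval → Fin n} (hg : Measurable g) (a : Fin n → unitInterval → ℝ)
    (ha : ∀ x y, k x y = a (g x) y) : IsCompactOperator (kernelOp hk) := by
  have hind : ∀ i, MemLp (Set.indicator (g ⁻¹' {i}) fun _ => (1 : ℝ)) 2
      (volume : Measure unitInterval) := fun i =>
    memLp_indicator_const 2 (hg (measurableSet_singleton i)) 1 (Or.inr (measure_ne_top _ _))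
  let V : Submodule ℝ UnitL2 := Submodule.span ℝ (Set.range fun i => (hind i).toLp _)
  have hV : FiniteDimensional ℝ V := FiniteDimensional.span_of_finite ℝ (Set.finite_range _)
  have hmem : ∀ f, kernelOp hk f ∈ V := by
    intro f
    -- The image of f is constant on each level set of g, so it is a combination of the n indicators
    -- spanning V.
    have h : kernelOp hk f = ∑ i, (∫ y, a i y * f y) • (hind i).toLp _ := by
      rw [kernelOp_apply]
      have h2 : ∀ i, (∫ y, a i y * f y) • (hind i).toLp _ =
          ((hind i).const_smul (∫ y, a i y * f y)).toLp _ := fun i =>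
        (MemLp.toLp_const_smul _ _).symm
      simp_rw [h2]
      rw [Lp.ext_iff]
      refine (MemLp.coeFn_toLp _).trans ?_
      have h3 := Lp.coeFn_finsetSum (Finset.univ : Finset (Fin n)) fun i =>
        ((hind i).const_smul (∫ y, a i y * f y)).toLp _
      have h4 : ∀ᵐ x, ∀ i, ((hind i).const_smul (∫ y, a i y * f y)).toLp _ x =
          ((∫ y, a i y * f y) • Set.indicator (g ⁻¹' {i}) fun _ => (1 : ℝ)) x :=
        ae_all_iff.2 fun i => MemLp.coeFn_toLp _
      filter_upwards [h3, h4] with x hx3 hx4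
      rw [hx3, Finset.sum_apply]
      simp_rw [hx4]
      simp only [Pi.smul_apply, smul_eq_mul, ha]
      rw [Finset.sum_eq_single (g x)]
      · simp
      · intro i _ hi
        have hx : x ∉ g ⁻¹' {i} := fun h => hi (Set.mem_singleton_iff.1 h).symm
        rw [Set.indicator_of_notMem hx, mul_zero]
      · simp
    rw [h]
    exact Submodule.sum_mem _ fun i _ =>
      Submodule.smul_mem _ _ (Submodule.subset_span ⟨i, rfl⟩)
  have hloc : LocallyCompactSpace V := by
    have := FiniteDimensional.proper ℝ V
    infer_instance
  exact (isCompactOperator_of_locallyCompactSpace_dom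
    ((kernelOp hk).codRestrict V hmem)).clm_comp V.subtypeL

end kernelOp

/-! ### Truncated spectral expansion of a compact symmetric operator -/

/-- The norm of a self-adjoint operator is its spectral radius, and the nonzero spectrum of a
compact operator consists of eigenvalues. -/
theorem ContinuousLinearMap.opNorm_le_of_hasEigenvalue_le {E : Type*} [NormedAddCommGroup E]
    [InnerProductSpace ℝ E] [CompleteSpace E] {R : E →L[ℝ] E} (hc : IsCompactOperator R)
    (hs : R.IsSymmetric) {δ : ℝ} (hδ : 0 ≤ δ)
    (h : ∀ μ : ℝ, ∀ v, R v = μ • v → v ≠ 0 → |μ| ≤ δ) : ‖R‖ ≤ δ := by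
  have h1 := R.spectralRadius_eq_nnnorm hs.isSelfAdjoint
  have h2 : spectralRadius ℝ R ≤ ENNReal.ofReal δ := by
    refine iSup₂_le fun μ hμ => ?_
    rcases eq_or_ne μ 0 with rfl | h0
    · simp
    · rw [← hc.hasEigenvalue_iff_mem_spectrum h0] at hμ
      obtain ⟨v, hv⟩ := hμ.exists_hasEigenvector
      have := h μ v hv.apply_eq_smul hv.2
      rw [← enorm_eq_nnnorm, Real.enorm_eq_ofReal_abs]
      exact ENNReal.ofReal_le_ofReal this
  rw [h1, ← enorm_eq_nnnorm, ← ofReal_norm, ENNReal.ofReal_le_ofReal_iff hδ] at h2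
  exact h2

/-- Truncated spectral expansion: removing the eigenvectors with eigenvalue beyond `δ` from the
quadratic form of a compact symmetric operator leaves a form of size at most `δ`. -/
theorem abs_inner_sub_sum_eigenvectors_le {E : Type*} [NormedAddCommGroup E]
    [InnerProductSpace ℝ E] [CompleteSpace E] {T : E →L[ℝ] E} (hc : IsCompactOperator T)
    (hs : T.IsSymmetric) {δ : ℝ} (hδ : 0 ≤ δ) {ι : Type*} [Fintype ι] {u : ι → E} {ν : ι → ℝ}
    (hu : Orthonormal ℝ u) (hT : ∀ i, T (u i) = ν i • u i)
    (hcomp : ∀ μ : ℝ, δ < |μ| → ∀ v, T v = μ • v → (∀ i, inner ℝ (u i) v = 0) → v = 0) (x : E) :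
    |inner ℝ x (T x) - ∑ i, ν i * inner ℝ (u i) x ^ 2| ≤ δ * ‖x‖ ^ 2 := by
  classical
  let P : E →L[ℝ] E := ∑ i, ν i • (innerSL ℝ (u i)).smulRight (u i)
  have hP : ∀ y, P y = ∑ i, (ν i * inner ℝ (u i) y) • u i := fun y => by
    simp [P, smul_smul]
  have hPc : IsCompactOperator P := by
    have : P ∈ compactOperator (RingHom.id ℝ) E E := by
      refine Submodule.sum_mem _ fun i _ => Submodule.smul_mem _ _ ?_
      change IsCompactOperator ((innerSL ℝ (u i)).smulRight (u i))
      exact (isCompactOperator_of_locallyCompactSpace_dom (innerSL ℝ (u i))).clm_comp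
        ((ContinuousLinearMap.id ℝ ℝ).smulRight (u i))
    exact this
  have hPs : P.IsSymmetric := by
    intro y z
    change inner ℝ (P y) z = inner ℝ y (P z)
    rw [hP, hP, sum_inner, inner_sum]
    refine Finset.sum_congr rfl fun i _ => ?_
    rw [real_inner_smul_left, real_inner_smul_right, real_inner_comm (u i) y]
    ring
  have hPu : ∀ i, P (u i) = ν i • u i := fun i => by
    rw [hP, Finset.sum_eq_single i]
    · simp [hu.1 i]
    · intro j _ hj
      simp [hu.2 hj]
    · simp
  have hRs : (T - P).IsSymmetric := LinearMap.IsSymmetric.sub hs hPs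
  have hR : ‖T - P‖ ≤ δ := by
    refine ContinuousLinearMap.opNorm_le_of_hasEigenvalue_le (hc.sub hPc) hRs hδ ?_
    intro μ v hv hv0
    by_contra! hμ
    have hμ0 : μ ≠ 0 := fun h => by rw [h, abs_zero] at hμ; linarith
    -- T − P kills every `u i`, so by symmetry its eigenvectors with nonzero eigenvalue are
    -- orthogonal to all of them. On such vectors P vanishes, so they are eigenvectors of T and
    -- `hcomp` applies.
    have horth : ∀ i, inner ℝ (u i) v = 0 := by
      intro i
      have h1 : inner ℝ ((T - P) (u i)) v = inner ℝ (u i) ((T - P) v) := hRs (u i) v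
      rw [hv, _root_.sub_apply, hT, hPu, sub_self, inner_zero_left,
        real_inner_smul_right] at h1
      exact (mul_eq_zero.1 h1.symm).resolve_left hμ0
    refine hv0 (hcomp μ hμ v ?_ horth)
    rw [_root_.sub_apply, hP] at hv
    simpa [horth] using hv
  have hx : inner ℝ x (T x) - ∑ i, ν i * inner ℝ (u i) x ^ 2 = inner ℝ x ((T - P) x) := by
    rw [_root_.sub_apply, inner_sub_right, hP, inner_sum]
    congr 1
    refine Finset.sum_congr rfl fun i _ => ?_
    rw [real_inner_smul_right, real_inner_comm (u i) x]
    ring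
  rw [hx]
  calc |inner ℝ x ((T - P) x)| ≤ ‖x‖ * ‖(T - P) x‖ := abs_real_inner_le_norm _ _
    _ ≤ ‖x‖ * (δ * ‖x‖) := by
        gcongr
        exact (T - P).le_of_opNorm_le hR x
    _ = δ * ‖x‖ ^ 2 := by ring

/-! ### Eigenfunctions, index and eigenspaces in L² -/

section Index

variable {K : unitInterval → unitInterval → ℝ} {C : ℝ}

theorem IsKernelEigenfunction.kernelOp_toLp (hK : IsBoundedKernel K C) {l : ℝ} (hl : l ≠ 0)
    {φ : unitInterval → ℝ} (hφ : MemLp φ 2 volume) (h : ∀ x, φ x = l * ∫ y, K x y * φ y) :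
    kernelOp hK (hφ.toLp φ) = (1 / l) • hφ.toLp φ := by
  rw [_root_.kernelOp_toLp, ← MemLp.toLp_const_smul]
  refine MemLp.toLp_congr _ _ (Filter.Eventually.of_forall fun x => ?_)
  rw [Pi.smul_apply, smul_eq_mul, h x, ← mul_assoc, one_div_mul_cancel hl, one_mul]

/-- The space of the square integrable solutions of `φ(x) = l ∫ K(x,y) φ(y) dy`. -/
def kernelSolutions (hK : IsBoundedKernel K C) (l : ℝ) : Submodule ℝ (unitInterval → ℝ) where
  carrier := {φ | MemLp φ 2 volume ∧ ∀ x, φ x = l * ∫ y, K x y * φ y}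
  zero_mem' := ⟨MemLp.zero, fun x => by simp⟩
  add_mem' := by
    rintro φ ψ ⟨hφ, h1⟩ ⟨hψ, h2⟩
    refine ⟨hφ.add hψ, fun x => ?_⟩
    have e : (∫ y, K x y * (φ + ψ) y) = (∫ y, K x y * φ y) + ∫ y, K x y * ψ y := by
      rw [← integral_add (hK.integrable_mul (hφ.integrable one_le_two) x)
        (hK.integrable_mul (hψ.integrable one_le_two) x)]
      simp only [Pi.add_apply, mul_add]
    rw [e, mul_add, ← h1 x, ← h2 x, Pi.add_apply]
  smul_mem' := by
    rintro c φ ⟨hφ, h1⟩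
    refine ⟨hφ.const_smul c, fun x => ?_⟩
    have e : (∫ y, K x y * (c • φ) y) = c * ∫ y, K x y * φ y := by
      rw [← integral_const_mul]
      congr 1 with y
      simp only [Pi.smul_apply, smul_eq_mul]
      ring
    rw [e, Pi.smul_apply, smul_eq_mul, mul_left_comm, ← h1 x]

/-- The equation holds at every point and its right side sees φ only almost everywhere, so a null
solution vanishes identically. -/
theorem eq_zero_of_ae_eq_zero {l : ℝ} {φ : unitInterval → ℝ}
    (h : ∀ x, φ x = l * ∫ y, K x y * φ y) (h0 : φ =ᵐ[volume] 0) : φ = 0 := by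
  ext x
  rw [h x, integral_kernel_congr h0 x]
  simp

theorem span_eigenfunctions (hK : IsBoundedKernel K C) (l : ℝ) :
    Submodule.span ℝ {φ | IsKernelEigenfunction K l φ} = kernelSolutions hK l := by
  have h : {φ | IsKernelEigenfunction K l φ} = (kernelSolutions hK l : Set _) \ {0} := by
    ext φ
    constructor
    · rintro ⟨h1, h2, h3⟩
      refine ⟨⟨h1, h3⟩, ?_⟩
      rintro rfl
      simp at h2
    · rintro ⟨⟨h1, h3⟩, h2⟩
      refine ⟨h1, ?_, h3⟩
      refine lt_of_le_of_ne (integral_nonneg fun x => sq_nonneg _) fun h0 => h2 ?_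
      have h4 := (integral_eq_zero_iff_of_nonneg (fun x => sq_nonneg (φ x)) h1.integrable_sq).1
        h0.symm
      refine eq_zero_of_ae_eq_zero h3 ?_
      filter_upwards [h4] with x hx
      simpa using hx
  rw [h, Submodule.span_sdiff_singleton_zero, Submodule.span_eq]

/-- Passing to L² classes loses nothing: solutions are determined by their class, and for f in the
eigenspace the function l ∫ K(x,y) f(y) dy is a representative solving the equation at every x. -/
theorem kernelIndex_eq_finrank (hK : IsBoundedKernel K C) {l : ℝ} (hl : l ≠ 0) :
    kernelIndex K l =
      Module.finrank ℝ (Module.End.eigenspace (kernelOp hK : UnitL2 →ₗ[ℝ] UnitL2) (1 / l)) := by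
  rw [kernelIndex, span_eigenfunctions hK l]
  let L : kernelSolutions hK l →ₗ[ℝ] UnitL2 :=
    { toFun := fun φ => φ.2.1.toLp φ.1
      map_add' := fun φ ψ => MemLp.toLp_add _ _
      map_smul' := fun c φ => MemLp.toLp_const_smul _ _ }
  have hinj : Function.Injective L := by
    rw [← LinearMap.ker_eq_bot, LinearMap.ker_eq_bot']
    intro φ hφ
    have h1 : (φ : unitInterval → ℝ) =ᵐ[volume] 0 :=
      φ.2.1.coeFn_toLp.symm.trans ((Lp.eq_zero_iff_ae_eq_zero).1 hφ)
    exact Subtype.ext (eq_zero_of_ae_eq_zero φ.2.2 h1)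
  have hrange : LinearMap.range L =
      Module.End.eigenspace (kernelOp hK : UnitL2 →ₗ[ℝ] UnitL2) (1 / l) := by
    ext f
    rw [Module.End.mem_eigenspace_iff, LinearMap.mem_range]
    constructor
    · rintro ⟨φ, rfl⟩
      exact IsKernelEigenfunction.kernelOp_toLp hK hl φ.2.1 φ.2.2
    · intro hf
      change kernelOp hK f = (1 / l) • f at hf
      have hm := (hK.memLp_integral (Lp.memLp f)).const_smul l
      have hae : (l • fun x => ∫ y, K x y * f y) =ᵐ[volume] f := by
        have h1 := (hK.memLp_integral (Lp.memLp f)).coeFn_toLp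
        rw [← kernelOp_apply hK, hf] at h1
        filter_upwards [h1, Lp.coeFn_smul (1 / l) f] with x hx1 hx2
        rw [Pi.smul_apply, ← hx1, hx2, Pi.smul_apply, smul_smul, mul_one_div_cancel hl, one_smul]
      refine ⟨⟨l • fun x => ∫ y, K x y * f y, hm, fun x => ?_⟩, ?_⟩
      · rw [integral_kernel_congr hae x, Pi.smul_apply, smul_eq_mul]
      · change hm.toLp _ = f
        rw [Lp.ext_iff]
        exact hm.coeFn_toLp.trans hae
  rw [← hrange, LinearMap.finrank_range_of_inj hinj]

end Index

/-- Bessel's inequality for the section K(x, ·), integrated over x, gives Σ ν_i² ≤ ∫∫ K² ≤ C². -/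
theorem card_mul_sq_le_of_orthonormal_eigenvectors {K : unitInterval → unitInterval → ℝ} {C : ℝ}
    (hK : IsBoundedKernel K C) {ι : Type*} [Fintype ι] {u : ι → UnitL2} (hu : Orthonormal ℝ u)
    {ν : ι → ℝ} (hT : ∀ i, kernelOp hK (u i) = ν i • u i) {δ : ℝ} (hδ : 0 ≤ δ)
    (hν : ∀ i, δ ≤ |ν i|) : Fintype.card ι * δ ^ 2 ≤ C ^ 2 := by
  have h1 : ∀ i, δ ^ 2 ≤ ∫ x, (∫ y, K x y * u i y) ^ 2 := fun i => by
    rw [← norm_toLp_sq (hK.memLp_integral (Lp.memLp (u i))), ← kernelOp_apply hK, hT, norm_smul,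
      hu.1 i, mul_one, Real.norm_eq_abs]
    exact pow_le_pow_left₀ hδ (hν i) 2
  have hint : ∀ i, Integrable (fun x => (∫ y, K x y * u i y) ^ 2) volume := fun i =>
    (hK.memLp_integral (Lp.memLp (u i))).integrable_sq
  have h2 : ∀ x, ∑ i, (∫ y, K x y * u i y) ^ 2 ≤ ∫ y, K x y ^ 2 := fun x => by
    have h := hu.sum_inner_products_le ((hK.memLp_right x).toLp (K x)) (s := Finset.univ)
    rw [norm_toLp_sq] at h
    refine le_trans (le_of_eq (Finset.sum_congr rfl fun i _ => ?_)) h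
    rw [Real.norm_eq_abs, sq_abs, real_inner_comm]
    conv_rhs => rw [← Lp.toLp_coeFn (u i) (Lp.memLp (u i))]
    rw [inner_toLp_toLp]
  calc (Fintype.card ι : ℝ) * δ ^ 2 = ∑ _i : ι, δ ^ 2 := by simp
    _ ≤ ∑ i, ∫ x, (∫ y, K x y * u i y) ^ 2 := Finset.sum_le_sum fun i _ => h1 i
    _ = ∫ x, ∑ i, (∫ y, K x y * u i y) ^ 2 := (integral_finsetSum _ fun i _ => hint i).symm
    _ ≤ ∫ x, ∫ y, K x y ^ 2 :=
        integral_mono (integrable_finsetSum _ fun i _ => hint i) hK.integrable_integral_sq h2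
    _ ≤ C ^ 2 := hK.integral_integral_sq_le

/-- Unit eigenvectors for distinct eigenvalues are orthonormal, so more than C²/δ² of these
eigenvalues would contradict the previous bound. -/
theorem finite_eigenvalues {K : unitInterval → unitInterval → ℝ} {C : ℝ}
    (hK : IsBoundedKernel K C) (hs : ∀ x y, K x y = K y x) {δ : ℝ} (hδ : 0 < δ) :
    {l : ℝ | 0 < l ∧ δ < 1 / l ∧ kernelIndex K l ≠ 0}.Finite := by
  by_contra hinf
  obtain ⟨m, hm⟩ := exists_nat_gt (C ^ 2 / δ ^ 2)
  obtain ⟨S, hS, hcard⟩ := Set.Infinite.exists_subset_card_eq hinf m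
  have hex : ∀ l : S, ∃ v : UnitL2, kernelOp hK v = (1 / (l : ℝ)) • v ∧ ‖v‖ = 1 := by
    rintro ⟨l, hl⟩
    obtain ⟨h0, -, h2⟩ := hS hl
    rw [kernelIndex_eq_finrank hK h0.ne'] at h2
    have hne : Module.End.eigenspace (kernelOp hK : UnitL2 →ₗ[ℝ] UnitL2) (1 / l) ≠ ⊥ := by
      intro hb
      rw [hb] at h2
      simp at h2
    obtain ⟨v, hv, hv0⟩ := Submodule.exists_mem_ne_zero_of_ne_bot hne
    have hv1 : kernelOp hK v = (1 / l) • v := Module.End.mem_eigenspace_iff.1 hv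
    refine ⟨(‖v‖⁻¹ : ℝ) • v, ?_, ?_⟩
    · rw [map_smul, hv1, smul_comm]
    · rw [norm_smul, norm_inv, norm_norm, inv_mul_cancel₀ (norm_ne_zero_iff.2 hv0)]
  choose v hv hv1 using hex
  have horth : Orthonormal ℝ v := by
    refine ⟨hv1, fun i j hij => ?_⟩
    have h := isSymmetric_kernelOp hK hs (v i) (v j)
    change inner ℝ (kernelOp hK (v i)) (v j) = inner ℝ (v i) (kernelOp hK (v j)) at h
    rw [hv, hv, real_inner_smul_left, real_inner_smul_right] at h
    by_contra h0
    have h3 := mul_right_cancel₀ h0 h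
    rw [one_div, one_div, inv_inj] at h3
    exact hij (Subtype.ext h3)
  have h := card_mul_sq_le_of_orthonormal_eigenvectors hK horth hv hδ.le fun l =>
    (hS l.2).2.1.le.trans (le_abs_self _)
  rw [Fintype.card_coe, hcard] at h
  rw [div_lt_iff₀ (by positivity)] at hm
  linarith

theorem Submodule.finrank_finset_sup_le {E ι : Type*} [AddCommGroup E] [Module ℝ E]
    (S : Finset ι) (V : ι → Submodule ℝ E) (hV : ∀ i ∈ S, FiniteDimensional ℝ (V i)) :
    FiniteDimensional ℝ (S.sup V : Submodule ℝ E) ∧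
      Module.finrank ℝ (S.sup V : Submodule ℝ E) ≤ ∑ i ∈ S, Module.finrank ℝ (V i) := by
  classical
  induction S using Finset.induction_on with
  | empty =>
    rw [Finset.sup_empty]
    exact ⟨inferInstance, by simp⟩
  | insert a S ha ih =>
    obtain ⟨h1, h2⟩ := ih fun i hi => hV i (Finset.mem_insert_of_mem hi)
    have h3 := hV a (Finset.mem_insert_self a S)
    rw [Finset.sup_insert, Finset.sum_insert ha]
    exact ⟨inferInstance, (Submodule.finrank_add_le_finrank_add_finrank _ _).trans (by omega)⟩

/-! ### Counting eigenvalues beyond the threshold -/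

section Enumeration

variable {K : unitInterval → unitInterval → ℝ} {C : ℝ}

/-- The positive eigenvalues `l` of `K` with `1 / l > δ`. -/
noncomputable def posEigenvalues (hK : IsBoundedKernel K C) (hs : ∀ x y, K x y = K y x) {δ : ℝ}
    (hδ : 0 < δ) : Finset ℝ := (finite_eigenvalues hK hs hδ).toFinset

/-- The number of positive eigenvalues `l` of `K` with `1 / l > δ`, counted with index. -/
noncomputable def posCount (hK : IsBoundedKernel K C) (hs : ∀ x y, K x y = K y x) {δ : ℝ}
    (hδ : 0 < δ) : ℕ := ∑ l ∈ posEigenvalues hK hs hδ, kernelIndex K l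

theorem mem_posEigenvalues (hK : IsBoundedKernel K C) (hs : ∀ x y, K x y = K y x) {δ : ℝ}
    (hδ : 0 < δ) {l : ℝ} :
    l ∈ posEigenvalues hK hs hδ ↔ 0 < l ∧ δ < 1 / l ∧ kernelIndex K l ≠ 0 := by
  simp [posEigenvalues]

/-- Keeps the set in `recipPosEigenvalue` bounded above, so that its supremum is meaningful. -/
theorem one_div_le_norm_of_kernelIndex_ne_zero (hK : IsBoundedKernel K C) {l : ℝ} (hl : 0 < l)
    (h : kernelIndex K l ≠ 0) : 1 / l ≤ ‖kernelOp hK‖ := by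
  rw [kernelIndex_eq_finrank hK hl.ne'] at h
  have hne : Module.End.eigenspace (kernelOp hK : UnitL2 →ₗ[ℝ] UnitL2) (1 / l) ≠ ⊥ := by
    intro hb
    rw [hb] at h
    simp at h
  obtain ⟨v, hv, hv0⟩ := Submodule.exists_mem_ne_zero_of_ne_bot hne
  have hv1 : kernelOp hK v = (1 / l) • v := Module.End.mem_eigenspace_iff.1 hv
  have h1 := (kernelOp hK).le_opNorm v
  rw [hv1, norm_smul, Real.norm_eq_abs, abs_of_pos (by positivity)] at h1
  exact le_of_mul_le_mul_right h1 (norm_pos_iff.2 hv0)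

/-- Makes the supremum usable: the indices j with reciprocal eigenvalue beyond δ are exactly an
initial segment, whose length is the total index. -/
theorem lt_recipPosEigenvalue_iff (hK : IsBoundedKernel K C) (hs : ∀ x y, K x y = K y x) {δ : ℝ}
    (hδ : 0 < δ) (j : ℕ) : δ < recipPosEigenvalue K j ↔ j < posCount hK hs hδ := by
  constructor
  · intro h
    have hne : {t : ℝ | 0 < t ∧ ∃ S : Finset ℝ,
        (∀ l ∈ S, 0 < l ∧ t ≤ 1 / l) ∧ j < ∑ l ∈ S, kernelIndex K l}.Nonempty := by
      by_contra hemp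
      rw [Set.not_nonempty_iff_eq_empty] at hemp
      -- The supremum of the empty set is 0, which does not exceed δ.
      rw [recipPosEigenvalue, hemp, Real.sSup_empty] at h
      linarith
    obtain ⟨t, ⟨-, S, hS, hj⟩, ht⟩ := exists_lt_of_lt_csSup hne h
    refine hj.trans_le ?_
    refine Finset.sum_le_sum_of_ne_zero fun l hl h0 => ?_
    exact (mem_posEigenvalues hK hs hδ).2 ⟨(hS l hl).1, ht.trans_le (hS l hl).2, h0⟩
  · intro h
    have hne : (posEigenvalues hK hs hδ).Nonempty := by
      by_contra hemp
      rw [Finset.not_nonempty_iff_eq_empty] at hemp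
      rw [posCount, hemp] at h
      simp at h
    -- The smallest of the finitely many values 1/l is still strictly above δ, and it serves as the
    -- witness t.
    obtain ⟨m, hm, hmin⟩ := Finset.exists_min_image _ (fun l : ℝ => 1 / l) hne
    have hm' := (mem_posEigenvalues hK hs hδ).1 hm
    refine hm'.2.1.trans_le (le_csSup ⟨‖kernelOp hK‖, ?_⟩ ?_)
    · rintro t ⟨-, S, hS, hj⟩
      obtain ⟨l, hl, hl0⟩ := Finset.exists_ne_zero_of_sum_ne_zero
        (by omega : ∑ l ∈ S, kernelIndex K l ≠ 0)
      exact (hS l hl).2.trans (one_div_le_norm_of_kernelIndex_ne_zero hK (hS l hl).1 hl0)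
    · exact ⟨one_div_pos.2 hm'.1, _, fun l hl =>
        ⟨((mem_posEigenvalues hK hs hδ).1 hl).1, hmin l hl⟩, h⟩

/-- As many orthonormal eigenvectors as there are eigenvalues beyond `δ` exhaust the eigenspaces
of these eigenvalues. -/
theorem eq_zero_of_orthogonal_eigenvectors (hK : IsBoundedKernel K C)
    (hs : ∀ x y, K x y = K y x) (hc : IsCompactOperator (kernelOp hK)) {δ : ℝ} (hδ : 0 < δ)
    {u : Fin (posCount hK hs hδ) → UnitL2} (hu : Orthonormal ℝ u)
    (hT : ∀ i, ∃ ν, δ < ν ∧ kernelOp hK (u i) = ν • u i) {μ : ℝ} (hμ : δ < μ) {v : UnitL2}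
    (hv : kernelOp hK v = μ • v) (horth : ∀ i, inner ℝ (u i) v = 0) : v = 0 := by
  let V : ℝ → Submodule ℝ UnitL2 := fun l =>
    Module.End.eigenspace (kernelOp hK : UnitL2 →ₗ[ℝ] UnitL2) (1 / l)
  have hfd : ∀ l : ℝ, 0 < l → FiniteDimensional ℝ (V l) := fun l hl =>
    ContinuousLinearMap.finite_dimensional_eigenspace hc _ (one_div_pos.2 hl).ne'
  have hpos : ∀ l ∈ posEigenvalues hK hs hδ, 0 < l := fun l hl =>
    ((mem_posEigenvalues hK hs hδ).1 hl).1
  obtain ⟨hW, hWn⟩ := Submodule.finrank_finset_sup_le (posEigenvalues hK hs hδ) V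
    fun l hl => hfd l (hpos l hl)
  have hmem : ∀ (w : UnitL2) (ν : ℝ), δ < ν → kernelOp hK w = ν • w →
      w ∈ (posEigenvalues hK hs hδ).sup V := by
    intro w ν hν hw
    rcases eq_or_ne w 0 with rfl | hw0
    · exact Submodule.zero_mem _
    have hν0 : 0 < ν := hδ.trans hν
    have hwV : w ∈ V (1 / ν) := by
      rw [Module.End.mem_eigenspace_iff, one_div_one_div]
      exact hw
    have hidx : kernelIndex K (1 / ν) ≠ 0 := by
      rw [kernelIndex_eq_finrank hK (one_div_pos.2 hν0).ne']
      have := hfd (1 / ν) (one_div_pos.2 hν0)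
      have hnt : Nontrivial (V (1 / ν)) :=
        ⟨⟨⟨w, hwV⟩, 0, fun h => hw0 (congrArg Subtype.val h)⟩⟩
      exact (Module.finrank_pos (R := ℝ) (M := V (1 / ν))).ne'
    exact Finset.le_sup (f := V) ((mem_posEigenvalues hK hs hδ).2
      ⟨one_div_pos.2 hν0, by rwa [one_div_one_div], hidx⟩) hwV
  have hle : Submodule.span ℝ (Set.range u) ≤ (posEigenvalues hK hs hδ).sup V := by
    rw [Submodule.span_le]
    rintro _ ⟨i, rfl⟩
    obtain ⟨ν, hν, h⟩ := hT i
    exact hmem _ ν hν h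
  -- The span lies in the sum of the eigenspaces, whose dimension is at most the sum of the indices,
  -- which is the number of vectors `u i`; so the two spaces agree.
  have heq : Submodule.span ℝ (Set.range u) = (posEigenvalues hK hs hδ).sup V := by
    refine Submodule.eq_of_le_of_finrank_le hle ?_
    rw [finrank_span_eq_card hu.linearIndependent, Fintype.card_fin]
    refine hWn.trans (le_of_eq ?_)
    exact Finset.sum_congr rfl fun l hl => (kernelIndex_eq_finrank hK (hpos l hl).ne').symm
  have hv' : v ∈ Submodule.span ℝ (Set.range u) := heq ▸ hmem v μ hμ hv
  have hperp : Submodule.span ℝ (Set.range u) ≤ (Submodule.span ℝ {v})ᗮ := by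
    rw [Submodule.span_le]
    rintro _ ⟨i, rfl⟩
    rw [SetLike.mem_coe, Submodule.mem_orthogonal_singleton_iff_inner_left]
    exact horth i
  have := hperp hv'
  rw [Submodule.mem_orthogonal_singleton_iff_inner_left] at this
  exact inner_self_eq_zero.1 this

theorem isKernelEigenfunction_neg_iff {l : ℝ} {φ : unitInterval → ℝ} :
    IsKernelEigenfunction (fun x y => -K x y) l φ ↔ IsKernelEigenfunction K (-l) φ := by
  have h : ∀ x, l * ∫ y, -K x y * φ y = -l * ∫ y, K x y * φ y := fun x => by
    simp only [neg_mul, integral_neg, mul_neg]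
  constructor
  · rintro ⟨h1, h2, h3⟩
    exact ⟨h1, h2, fun x => (h3 x).trans (h x)⟩
  · rintro ⟨h1, h2, h3⟩
    exact ⟨h1, h2, fun x => (h3 x).trans (h x).symm⟩

theorem kernelIndex_neg (l : ℝ) :
    kernelIndex (fun x y => -K x y) l = kernelIndex K (-l) := by
  have h : {φ | IsKernelEigenfunction (fun x y => -K x y) l φ} =
      {φ | IsKernelEigenfunction K (-l) φ} := Set.ext fun _ => isKernelEigenfunction_neg_iff
  rw [kernelIndex, kernelIndex, h]

/-- Negating K exchanges the two signs of eigenvalues, so the negative side follows from the results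
on the positive side. -/
theorem recipNegEigenvalue_eq (j : ℕ) :
    recipNegEigenvalue K j = -recipPosEigenvalue (fun x y => -K x y) j := by
  rw [recipNegEigenvalue, recipPosEigenvalue, Real.sInf_def]
  congr 2
  ext t
  simp only [Set.mem_neg, Set.mem_ofPred_eq, kernelIndex_neg]
  refine and_congr (by simp) ⟨?_, ?_⟩
  · rintro ⟨S, h1, h2⟩
    refine ⟨S.map (Equiv.neg ℝ).toEmbedding, ?_, ?_⟩
    · intro l hl
      obtain ⟨m, hm, rfl⟩ := Finset.mem_map.1 hl
      obtain ⟨h3, h4⟩ := h1 m hm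
      refine ⟨by simpa using h3, ?_⟩
      simp only [Equiv.coe_toEmbedding, Equiv.neg_apply, div_neg]
      linarith
    · simpa using h2
  · rintro ⟨S, h1, h2⟩
    refine ⟨S.map (Equiv.neg ℝ).toEmbedding, ?_, ?_⟩
    · intro l hl
      obtain ⟨m, hm, rfl⟩ := Finset.mem_map.1 hl
      obtain ⟨h3, h4⟩ := h1 m hm
      refine ⟨by simpa using h3, ?_⟩
      simp only [Equiv.coe_toEmbedding, Equiv.neg_apply, div_neg]
      linarith
    · simpa using h2

end Enumeration

/-! ### The kernel K and the cost of rounding to the grid -/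

theorem isBoundedKernel_mertensKernel : IsBoundedKernel mertensKernel (1 / 2) where
  measurable := by
    have h1 : Measurable fun z : unitInterval × unitInterval => (z.1 : ℝ) :=
      measurable_subtype_coe.comp measurable_fst
    have h2 : Measurable fun z : unitInterval × unitInterval => (z.2 : ℝ) :=
      measurable_subtype_coe.comp measurable_snd
    refine Measurable.ite ?_ ?_ measurable_const
    · exact (measurableSet_lt measurable_const h1).inter (measurableSet_lt measurable_const h2)
    · exact measurable_const.sub (measurable_fract.comp (measurable_const.div (h1.mul h2)))
  bound := fun x y => by
    unfold mertensKernel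
    split_ifs
    · have h1 := Int.fract_nonneg (1 / ((x : ℝ) * (y : ℝ)))
      have h2 := (Int.fract_lt_one (1 / ((x : ℝ) * (y : ℝ)))).le
      rw [abs_le]
      constructor <;> linarith
    · norm_num

theorem mertensKernel_comm (x y : unitInterval) : mertensKernel x y = mertensKernel y x := by
  simp only [mertensKernel, mul_comm (x : ℝ), and_comm (a := 0 < (x : ℝ))]

/-- The map rounding a point of `[0,1]` up to the next multiple of `1 / N`. -/
noncomputable def gridCeil (N : ℕ) (x : unitInterval) : unitInterval := gridPoint N ⌈(N : ℝ) * x⌉₊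

theorem measurable_ceil_mul (N : ℕ) : Measurable fun x : unitInterval => ⌈(N : ℝ) * x⌉₊ :=
  Nat.measurable_ceil.comp (measurable_subtype_coe.const_mul _)

theorem ceil_mul_le (N : ℕ) (x : unitInterval) : ⌈(N : ℝ) * x⌉₊ ≤ N :=
  Nat.ceil_le.2 (mul_le_of_le_one_right (Nat.cast_nonneg N) x.2.2)

theorem measurable_gridCeil (N : ℕ) : Measurable (gridCeil N) :=
  (measurable_from_nat (f := gridPoint N)).comp (measurable_ceil_mul N)

theorem coe_gridCeil (N : ℕ) (x : unitInterval) :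
    (gridCeil N x : ℝ) = (⌈(N : ℝ) * x⌉₊ : ℝ) / N :=
  coe_gridPoint (ceil_mul_le N x)

theorem le_gridCeil {N : ℕ} (hN : 1 ≤ N) (x : unitInterval) : (x : ℝ) ≤ gridCeil N x := by
  have hN0 : (0 : ℝ) < N := by exact_mod_cast hN
  rw [coe_gridCeil, le_div_iff₀ hN0, mul_comm]
  exact Nat.le_ceil _

theorem gridCeil_le {N : ℕ} (hN : 1 ≤ N) (x : unitInterval) :
    (gridCeil N x : ℝ) ≤ x + 1 / N := by
  have hN0 : (0 : ℝ) < N := by exact_mod_cast hN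
  rw [coe_gridCeil, div_le_iff₀ hN0, add_mul, one_div_mul_cancel hN0.ne', mul_comm (x : ℝ)]
  exact (Nat.ceil_lt_add_one (mul_nonneg hN0.le x.2.1)).le

theorem integral_unitInterval (f : ℝ → ℝ) :
    ∫ x : unitInterval, f x = ∫ x in (0 : ℝ)..1, f x := by
  rw [unitInterval.measurePreserving_coe.integral_comp unitInterval.measurableEmbedding_coe,
    intervalIntegral.integral_of_le zero_le_one, ← integral_Icc_eq_integral_Ioc]

theorem integrable_unitInterval {f : ℝ → ℝ} (hf : IntervalIntegrable f volume 0 1) :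
    Integrable (fun x : unitInterval => f x) volume := by
  have h : Integrable f (volume.restrict (Set.Icc (0 : ℝ) 1)) := by
    rw [intervalIntegrable_iff_integrableOn_Icc_of_le zero_le_one] at hf
    exact hf
  exact (unitInterval.measurePreserving_coe.integrable_comp_emb
    unitInterval.measurableEmbedding_coe).2 h

theorem ae_pos_unitInterval : ∀ᵐ x : unitInterval, 0 < (x : ℝ) := by
  have h : ∀ᵐ x : unitInterval, x ≠ 0 := by
    rw [ae_iff]
    simp
  filter_upwards [h] with x hx
  exact lt_of_le_of_ne x.2.1 fun h0 => hx (Subtype.ext h0.symm)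

/-- For an antitone function, the integral of `g(x) - g(x + h)` telescopes. -/
theorem integral_sub_comp_add_le {g : ℝ → ℝ} {a b h : ℝ} (hab : a ≤ b) (hh : 0 ≤ h)
    (hg : AntitoneOn g (Set.Ici a)) (hg0 : ∀ x, a ≤ x → 0 ≤ g x) :
    IntervalIntegrable (fun x => g x - g (x + h)) volume a b ∧
      ∫ x in a..b, (g x - g (x + h)) ≤ h * g a := by
  have hint : ∀ c d, a ≤ c → a ≤ d → IntervalIntegrable g volume c d := fun c d hc hd =>
    (hg.mono fun x hx => (le_inf hc hd).trans hx.1).intervalIntegrable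
  have h1 : IntervalIntegrable (fun x => g (x + h)) volume a b := by
    have := (hint (a + h) (b + h) (by linarith) (by linarith)).comp_add_right h
    simpa using this
  refine ⟨(hint a b le_rfl hab).sub h1, ?_⟩
  -- After translation the difference is the integral of g over [a, a+h] minus that over [b, b+h];
  -- the second is nonnegative and the first at most h g(a).
  rw [intervalIntegral.integral_sub (hint a b le_rfl hab) h1,
    intervalIntegral.integral_comp_add_right g h,
    intervalIntegral.integral_interval_sub_interval_comm (hint a b le_rfl hab)
      (hint _ _ (by linarith) (by linarith)) (hint _ _ le_rfl (by linarith))]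
  have h2 : 0 ≤ ∫ x in b..b + h, g x :=
    intervalIntegral.integral_nonneg (by linarith) fun x hx => hg0 x (hab.trans hx.1)
  have h3 : ∫ x in a..a + h, g x ≤ ∫ _x in a..a + h, g a :=
    intervalIntegral.integral_mono_on (by linarith) (hint _ _ le_rfl (by linarith))
      intervalIntegrable_const fun x hx => hg Set.self_mem_Ici hx.1 hx.1
  rw [intervalIntegral.integral_const, smul_eq_mul] at h3
  linarith

theorem abs_mertensKernel_sub_le_one (x x' y : unitInterval) :
    |mertensKernel x' y - mertensKernel x y| ≤ 1 := by
  have h1 := isBoundedKernel_mertensKernel.bound x y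
  have h2 := isBoundedKernel_mertensKernel.bound x' y
  have := abs_sub (mertensKernel x' y) (mertensKernel x y)
  linarith

/-- Since {t} = t − ⌊t⌋, the change of K is a difference of the decreases of t and ⌊t⌋ for t =
1/(xy). Bounding it by their sum leaves the decrease of the single antitone function t + ⌊t⌋, whose
integral telescopes. -/
theorem abs_mertensKernel_sub_le {x x' y : unitInterval} (hx : 0 < (x : ℝ)) (hy : 0 < (y : ℝ))
    (hxx' : (x : ℝ) ≤ x') :
    |mertensKernel x' y - mertensKernel x y| ≤
      (1 / ((x : ℝ) * y) + ⌊1 / ((x : ℝ) * y)⌋) - (1 / ((x' : ℝ) * y) + ⌊1 / ((x' : ℝ) * y)⌋) := by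
  have hx' : 0 < (x' : ℝ) := hx.trans_le hxx'
  have h1 : 1 / ((x' : ℝ) * y) ≤ 1 / ((x : ℝ) * y) := by gcongr
  have h2 : (⌊1 / ((x' : ℝ) * y)⌋ : ℝ) ≤ ⌊1 / ((x : ℝ) * y)⌋ := by
    exact_mod_cast Int.floor_le_floor h1
  rw [mertensKernel, mertensKernel, if_pos ⟨hx', hy⟩, if_pos ⟨hx, hy⟩, Int.fract, Int.fract, abs_le]
  constructor <;> linarith

/-- The bound for the error made by rounding up one argument of the kernel. -/
noncomputable def roundingBound (N : ℕ) (y : ℝ) : ℝ := min 1 (3 / √(N * y))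

/-- Cut at a = 1/√(Ny). Below a the integrand is at most 1 and contributes at most a; above a,
telescoping with step 1/N contributes at most 2/(Nay) = 2a. This choice of a balances the two. -/
theorem integral_abs_mertensKernel_sub_le {N : ℕ} (hN : 1 ≤ N) {y : unitInterval}
    (hy : 0 < (y : ℝ)) :
    ∫ x, |mertensKernel (gridCeil N x) y - mertensKernel x y| ≤ roundingBound N y := by
  have hN0 : (0 : ℝ) < N := by exact_mod_cast hN
  have hmeas : Integrable
      (fun x => |mertensKernel (gridCeil N x) y - mertensKernel x y|) volume := by
    refine integrable_of_measurable_of_bound (C := 1) ?_ fun x => ?_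
    · have h := (isBoundedKernel_mertensKernel.comp_left (measurable_gridCeil N)).sub
        isBoundedKernel_mertensKernel
      exact continuous_abs.measurable.comp (h.measurable_left y)
    · rw [abs_abs]
      exact abs_mertensKernel_sub_le_one _ _ _
  have hone : ∫ x, |mertensKernel (gridCeil N x) y - mertensKernel x y| ≤ 1 := by
    calc _ ≤ ∫ _x : unitInterval, (1 : ℝ) :=
          integral_mono hmeas (integrable_const _) fun x => abs_mertensKernel_sub_le_one _ _ _
      _ = 1 := by simp
  refine le_min hone ?_
  have hNy : 0 < (N : ℝ) * y := mul_pos hN0 hy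
  have hs0 : 0 < √((N : ℝ) * y) := Real.sqrt_pos.2 hNy
  have hss : √((N : ℝ) * y) * √((N : ℝ) * y) = N * y := Real.mul_self_sqrt hNy.le
  generalize √((N : ℝ) * y) = s at hs0 hss ⊢
  obtain ⟨a, ha⟩ : ∃ a, a = 1 / s := ⟨_, rfl⟩
  have ha0 : 0 < a := by rw [ha]; positivity
  -- If a ≥ 1 the cut falls outside the interval, and the trivial bound 1 is already below 3a.
  rcases le_or_gt 1 a with ha1 | ha1
  · refine hone.trans (ha1.trans ?_)
    rw [ha]
    gcongr
    norm_num
  let g : ℝ → ℝ := fun x => 1 / (x * y) + ⌊1 / (x * y)⌋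
  have hganti : AntitoneOn g (Set.Ici a) := by
    intro s hs' t _ hst
    have hs0 : 0 < s := ha0.trans_le hs'
    have h1 : 1 / (t * (y : ℝ)) ≤ 1 / (s * y) := by gcongr
    have h2 : (⌊1 / (t * (y : ℝ))⌋ : ℝ) ≤ ⌊1 / (s * (y : ℝ))⌋ := by
      exact_mod_cast Int.floor_le_floor h1
    exact add_le_add h1 h2
  have hg0 : ∀ s, a ≤ s → 0 ≤ g s := fun s hs' => by
    have h1 : 0 ≤ 1 / (s * (y : ℝ)) := by
      have := ha0.trans_le hs'
      positivity
    have h2 : (0 : ℝ) ≤ ⌊1 / (s * (y : ℝ))⌋ := by exact_mod_cast Int.floor_nonneg.2 h1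
    exact add_nonneg h1 h2
  obtain ⟨hgi, hgle⟩ := integral_sub_comp_add_le ha1.le (one_div_pos.2 hN0).le hganti hg0
  let F : ℝ → ℝ := fun x => if x ≤ a then 1 else g x - g (x + 1 / N)
  have hF1 : Set.EqOn (fun _ => (1 : ℝ)) F (Set.uIoc 0 a) := by
    intro x hx
    rw [Set.uIoc_of_le ha0.le] at hx
    simp only [F, if_pos hx.2]
  have hF2 : Set.EqOn (fun x => g x - g (x + 1 / N)) F (Set.uIoc a 1) := by
    intro x hx
    rw [Set.uIoc_of_le ha1.le] at hx
    simp only [F, if_neg (not_le.2 hx.1)]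
  have hFi1 : IntervalIntegrable F volume 0 a :=
    (intervalIntegrable_const (c := (1 : ℝ))).congr hF1
  have hFi2 : IntervalIntegrable F volume a 1 := hgi.congr hF2
  have hle : ∀ x : unitInterval,
      |mertensKernel (gridCeil N x) y - mertensKernel x y| ≤ F x := by
    intro x
    by_cases hx : (x : ℝ) ≤ a
    · simp only [F, if_pos hx]
      exact abs_mertensKernel_sub_le_one _ _ _
    · simp only [F, if_neg hx]
      have hx0 : a < x := not_le.1 hx
      refine (abs_mertensKernel_sub_le (ha0.trans hx0) hy (le_gridCeil hN x)).trans ?_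
      exact sub_le_sub_left (hganti (hx0.le.trans (le_gridCeil hN x))
        (by rw [Set.mem_Ici]; have := one_div_pos.2 hN0; linarith) (gridCeil_le hN x)) _
  calc ∫ x, |mertensKernel (gridCeil N x) y - mertensKernel x y|
      ≤ ∫ x : unitInterval, F x :=
        integral_mono hmeas (integrable_unitInterval (hFi1.trans hFi2)) hle
    _ = (∫ x in (0 : ℝ)..a, F x) + ∫ x in a..1, F x := by
        rw [integral_unitInterval, intervalIntegral.integral_add_adjacent_intervals hFi1 hFi2]
    _ ≤ a + 1 / N * g a := by
        refine add_le_add (le_of_eq ?_) (le_trans (le_of_eq ?_) hgle)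
        · rw [intervalIntegral.integral_congr_ae (.of_forall fun x hx => (hF1 hx).symm)]
          simp
        · exact intervalIntegral.integral_congr_ae (.of_forall fun x hx => (hF2 hx).symm)
    _ ≤ a + 1 / N * (2 * (1 / (a * y))) := by
        have : g a ≤ 2 * (1 / (a * y)) := by
          have := Int.floor_le (1 / (a * (y : ℝ)))
          simp only [g]
          linarith
        gcongr
    _ = 3 / s := by
        have h1 : 1 / (N : ℝ) * (2 * (1 / (a * y))) = 2 * s / (N * y) := by
          rw [ha]
          field_simp
        rw [h1, ← hss, ha]
        field_simp
        norm_num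

/-- The error scale `√((1 + log N) / N)`. -/
noncomputable def gridError (N : ℕ) : ℝ := √((1 + Real.log (N : ℝ)) / (N : ℝ))

theorem gridError_sq {N : ℕ} (hN : 1 ≤ N) : gridError N ^ 2 = (1 + Real.log N) / N := by
  have : 0 ≤ Real.log (N : ℝ) := Real.log_natCast_nonneg N
  exact Real.sq_sqrt (by positivity)

theorem gridError_nonneg (N : ℕ) : 0 ≤ gridError N := Real.sqrt_nonneg _

theorem one_div_le_gridError {N : ℕ} (hN : 1 ≤ N) : 1 / (N : ℝ) ≤ gridError N := by
  have hN1 : (1 : ℝ) ≤ N := by exact_mod_cast hN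
  have hlog : 0 ≤ Real.log (N : ℝ) := Real.log_natCast_nonneg N
  refine Real.le_sqrt_of_sq_le ?_
  rw [div_pow, one_pow, div_le_div_iff₀ (by positivity) (by positivity)]
  nlinarith [mul_nonneg hlog (by positivity : (0 : ℝ) ≤ (N : ℝ) ^ 2)]

theorem tendsto_gridError : Filter.Tendsto gridError Filter.atTop (nhds 0) := by
  have h1 : Filter.Tendsto (fun x : ℝ => 1 / x + Real.log x / x) Filter.atTop (nhds (0 + 0)) := by
    refine Filter.Tendsto.add ?_ ?_
    · exact tendsto_inv_atTop_zero.congr fun x => (one_div x).symm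
    · simpa using Real.tendsto_pow_log_div_mul_add_atTop 1 0 1 one_ne_zero
  have h2 := (h1.comp (tendsto_natCast_atTop_atTop (R := ℝ))).sqrt
  rw [add_zero, Real.sqrt_zero] at h2
  refine h2.congr fun n => ?_
  simp only [Function.comp, gridError, add_div]

theorem roundingBound_nonneg (N : ℕ) (y : ℝ) : 0 ≤ roundingBound N y :=
  le_min zero_le_one (by positivity)

theorem roundingBound_le_one (N : ℕ) (y : ℝ) : roundingBound N y ≤ 1 := min_le_left _ _

theorem roundingBound_anti {N : ℕ} (hN : 1 ≤ N) {y y' : ℝ} (hy : 0 < y) (h : y ≤ y') :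
    roundingBound N y' ≤ roundingBound N y := by
  have hN0 : (0 : ℝ) < N := by exact_mod_cast hN
  have : 0 < √((N : ℝ) * y) := Real.sqrt_pos.2 (mul_pos hN0 hy)
  exact min_le_min le_rfl (by gcongr)

theorem memLp_roundingBound (N : ℕ) :
    MemLp (fun y : unitInterval => roundingBound N y) 2 volume := by
  refine memLp_of_measurable_of_bound (C := 1) ?_ fun y => ?_
  · exact measurable_const.min (measurable_const.div
      (measurable_subtype_coe.const_mul _).sqrt)
  · rw [abs_of_nonneg (roundingBound_nonneg _ _)]
    exact roundingBound_le_one _ _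

/-- Cut at 1/N: the bound 1 contributes 1/N, and 9/(Ny) on the rest contributes 9 log N / N. This is
the source of the logarithm. -/
theorem integral_roundingBound_sq_le {N : ℕ} (hN : 1 ≤ N) :
    ∫ y : unitInterval, roundingBound N y ^ 2 ≤ (3 * gridError N) ^ 2 := by
  have hN1 : (1 : ℝ) ≤ N := by exact_mod_cast hN
  have hN0 : (0 : ℝ) < N := by linarith
  have ha0 : 0 < 1 / (N : ℝ) := by positivity
  have ha1 : 1 / (N : ℝ) ≤ 1 := by rw [div_le_one hN0]; exact hN1
  let F : ℝ → ℝ := fun y => if y ≤ 1 / N then 1 else 9 / N * (1 / y)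
  have hgi : IntervalIntegrable (fun y : ℝ => 9 / (N : ℝ) * (1 / y)) volume (1 / N) 1 := by
    refine (intervalIntegral.intervalIntegrable_one_div (fun x hx => ?_)
      continuousOn_id).const_mul _
    rw [Set.uIcc_of_le ha1] at hx
    exact (ha0.trans_le hx.1).ne'
  have hF1 : Set.EqOn (fun _ => (1 : ℝ)) F (Set.uIoc 0 (1 / N)) := by
    intro x hx
    rw [Set.uIoc_of_le ha0.le] at hx
    simp only [F, if_pos hx.2]
  have hF2 : Set.EqOn (fun y : ℝ => 9 / (N : ℝ) * (1 / y)) F (Set.uIoc (1 / N) 1) := by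
    intro x hx
    rw [Set.uIoc_of_le ha1] at hx
    simp only [F, if_neg (not_le.2 hx.1)]
  have hFi1 : IntervalIntegrable F volume 0 (1 / N) :=
    (intervalIntegrable_const (c := (1 : ℝ))).congr hF1
  have hFi2 : IntervalIntegrable F volume (1 / N) 1 := hgi.congr hF2
  have hle : ∀ y : unitInterval, roundingBound N y ^ 2 ≤ F y := by
    intro y
    by_cases hy : (y : ℝ) ≤ 1 / N
    · simp only [F, if_pos hy]
      exact pow_le_one₀ (roundingBound_nonneg _ _) (roundingBound_le_one _ _)
    · simp only [F, if_neg hy]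
      have hy0 : 0 < (y : ℝ) := ha0.trans (not_le.1 hy)
      calc roundingBound N y ^ 2 ≤ (3 / √(N * y)) ^ 2 :=
            pow_le_pow_left₀ (roundingBound_nonneg _ _) (min_le_right _ _) 2
        _ = 9 / N * (1 / y) := by
            rw [div_pow, Real.sq_sqrt (by positivity)]
            field_simp
            norm_num
  calc ∫ y : unitInterval, roundingBound N y ^ 2 ≤ ∫ y : unitInterval, F y :=
        integral_mono (memLp_roundingBound N).integrable_sq
          (integrable_unitInterval (hFi1.trans hFi2)) hle
    _ = (∫ x in (0 : ℝ)..(1 / N), F x) + ∫ x in (1 / N : ℝ)..1, F x := by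
        rw [integral_unitInterval, intervalIntegral.integral_add_adjacent_intervals hFi1 hFi2]
    _ = 1 / N + 9 / N * Real.log N := by
        rw [intervalIntegral.integral_congr_ae (.of_forall fun x hx => (hF1 hx).symm),
          intervalIntegral.integral_congr_ae (.of_forall fun x hx => (hF2 hx).symm),
          intervalIntegral.integral_const_mul, integral_one_div_of_pos ha0 one_pos,
          one_div_one_div]
        simp
    _ ≤ (3 * gridError N) ^ 2 := by
        rw [mul_pow, gridError_sq hN]
        have : 9 * ((1 + Real.log N) / N) - (1 / N + 9 / N * Real.log N) = 8 / N := by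
          field_simp
          ring
        have h8 : 0 ≤ 8 / (N : ℝ) := by positivity
        norm_num only at this ⊢
        linarith

/-- Cauchy–Schwarz against the constant 1. -/
theorem integral_roundingBound_le {N : ℕ} (hN : 1 ≤ N) :
    ∫ y : unitInterval, roundingBound N y ≤ 3 * gridError N := by
  have h := sq_integral_mul_le (memLp_roundingBound N)
    (memLp_const (1 : ℝ) (μ := (volume : Measure unitInterval)))
  simp only [mul_one, one_pow, integral_const, probReal_univ, smul_eq_mul] at h
  exact le_of_sq_le_sq (h.trans (integral_roundingBound_sq_le hN))
    (mul_nonneg (by norm_num) (gridError_nonneg N))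

theorem IsBoundedKernel.integrable_uncurry {k : unitInterval → unitInterval → ℝ} {C : ℝ}
    (hk : IsBoundedKernel k C) : Integrable (Function.uncurry k) (volume.prod volume) :=
  Integrable.of_bound hk.measurable.aestronglyMeasurable C
    (Filter.Eventually.of_forall fun z => hk.bound z.1 z.2)

theorem isBoundedKernel_gridCeil_left (N : ℕ) :
    IsBoundedKernel (fun x y => mertensKernel (gridCeil N x) y) (1 / 2) :=
  isBoundedKernel_mertensKernel.comp_left (measurable_gridCeil N)

theorem isBoundedKernel_abs_sub (N : ℕ) :
    IsBoundedKernel (fun x y => |mertensKernel (gridCeil N x) y - mertensKernel x y|) 1 where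
  measurable := continuous_abs.measurable.comp
    ((isBoundedKernel_gridCeil_left N).sub isBoundedKernel_mertensKernel).measurable
  bound := fun x y => by
    rw [abs_abs]
    exact abs_mertensKernel_sub_le_one _ _ _

theorem integral_integral_abs_sub_le {N : ℕ} (hN : 1 ≤ N) :
    ∫ x, ∫ y, |mertensKernel (gridCeil N x) y - mertensKernel x y| ≤ 3 * gridError N := by
  have hint := (isBoundedKernel_abs_sub N).integrable_uncurry
  rw [integral_integral_swap hint]
  refine le_trans (integral_mono_ae hint.integral_prod_right
    ((memLp_roundingBound N).integrable one_le_two) ?_) (integral_roundingBound_le hN)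
  filter_upwards [ae_pos_unitInterval] with y hy
  exact integral_abs_mertensKernel_sub_le hN hy

/-! ### Compactness of the operator of K -/

theorem isCompactOperator_gridCeil_left (N : ℕ) :
    IsCompactOperator (kernelOp (isBoundedKernel_gridCeil_left N)) := by
  -- There are N + 1 values because the point 0 is rounded to 0.
  refine isCompactOperator_kernelOp_of_factor _ (n := N + 1)
    (g := fun x => ⟨⌈(N : ℝ) * x⌉₊, Nat.lt_succ_of_le (ceil_mul_le N x)⟩) ?_
    (fun i => mertensKernel (gridPoint N i)) fun x y => rfl
  refine measurable_to_countable' fun i => ?_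
  have := measurable_ceil_mul N (measurableSet_singleton (i : ℕ))
  convert this using 1
  ext x
  simp [Fin.ext_iff]

/-- The finite rank operators with x rounded to the grid converge in norm. As the kernels differ by
at most 1, the squared L² distance is at most the L¹ distance, which tends to 0. -/
theorem isCompactOperator_mertensKernel :
    IsCompactOperator (kernelOp isBoundedKernel_mertensKernel) := by
  refine isCompactOperator_of_tendsto (l := Filter.atTop)
    (F := fun N => kernelOp (isBoundedKernel_gridCeil_left N)) ?_
    (Filter.Eventually.of_forall isCompactOperator_gridCeil_left)
  rw [tendsto_iff_norm_sub_tendsto_zero]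
  have h : Filter.Tendsto (fun N => √(3 * gridError N)) Filter.atTop (nhds 0) := by
    have := (tendsto_gridError.const_mul 3).sqrt
    rwa [mul_zero, Real.sqrt_zero] at this
  refine squeeze_zero' (Filter.Eventually.of_forall fun _ => norm_nonneg _) ?_ h
  filter_upwards [Filter.eventually_ge_atTop 1] with N hN
  refine (norm_kernelOp_sub_le _ _).trans (Real.sqrt_le_sqrt ?_)
  refine le_trans ?_ (integral_integral_abs_sub_le hN)
  have hd := (isBoundedKernel_gridCeil_left N).sub isBoundedKernel_mertensKernel
  have ha := isBoundedKernel_abs_sub N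
  refine integral_mono hd.integrable_integral_sq ha.integrable_uncurry.integral_prod_left
    fun x => ?_
  refine integral_mono (hd.memLp_right x).integrable_sq
    (integrable_of_measurable_of_bound (ha.measurable_right x) (ha.bound x)) fun y => ?_
  have h1 := abs_mertensKernel_sub_le_one x (gridCeil N x) y
  have h0 := abs_nonneg (mertensKernel (gridCeil N x) y - mertensKernel x y)
  simp only
  rw [← sq_abs]
  nlinarith

theorem integral_ceil_mul {N : ℕ} (hN : 1 ≤ N) (F : ℕ → ℝ) :
    ∫ x : unitInterval, F ⌈(N : ℝ) * x⌉₊ = (1 / N) * ∑ n ∈ Finset.Icc 1 N, F n := by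
  have hN0 : (0 : ℝ) < N := by exact_mod_cast hN
  have hle : ∀ k : ℕ, (k : ℝ) / N ≤ ((k + 1 : ℕ) : ℝ) / N := fun k => by
    gcongr
    exact Nat.le_succ k
  have heq : ∀ k : ℕ, Set.EqOn (fun _ => F (k + 1)) (fun x : ℝ => F ⌈(N : ℝ) * x⌉₊)
      (Set.uIoc ((k : ℝ) / N) (((k + 1 : ℕ) : ℝ) / N)) := by
    intro k x hx
    rw [Set.uIoc_of_le (hle k)] at hx
    obtain ⟨h1, h2⟩ := hx
    rw [div_lt_iff₀ hN0] at h1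
    rw [le_div_iff₀ hN0] at h2
    have : ⌈(N : ℝ) * x⌉₊ = k + 1 := by
      rw [Nat.ceil_eq_iff (Nat.succ_ne_zero k), mul_comm]
      exact ⟨by simpa using h1, h2⟩
    simp only [this]
  have hint : ∀ k < N, IntervalIntegrable (fun x : ℝ => F ⌈(N : ℝ) * x⌉₊) volume
      ((k : ℝ) / N) (((k + 1 : ℕ) : ℝ) / N) := fun k _ =>
    intervalIntegrable_const.congr (heq k)
  have h := intervalIntegral.sum_integral_adjacent_intervals (a := fun k : ℕ => (k : ℝ) / N) hint
  simp only [Nat.cast_zero, zero_div, div_self hN0.ne'] at h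
  have hI : Finset.Icc 1 N = Finset.Ico (0 + 1) (N + 1) := by
    ext n
    simp only [Finset.mem_Icc, Finset.mem_Ico]
    omega
  rw [integral_unitInterval (fun x => F ⌈(N : ℝ) * x⌉₊), ← h, Finset.mul_sum,
    Finset.range_eq_Ico, hI, ← Finset.sum_Ico_add' (fun n => 1 / (N : ℝ) * F n) 0 N 1]
  refine Finset.sum_congr rfl fun k _ => ?_
  rw [intervalIntegral.integral_congr_ae (.of_forall fun x hx => (heq k hx).symm),
    intervalIntegral.integral_const, smul_eq_mul, ← sub_div]
  push_cast
  rw [add_sub_cancel_left]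

/-! ### Meissel's identity and the quadratic form in μ -/

section Meissel

open ArithmeticFunction

/-- The Möbius function cut off beyond `N`. -/
def truncatedMoebius (N : ℕ) : ArithmeticFunction ℤ :=
  ⟨fun n => if n ≤ N then moebius n else 0, by simp⟩

theorem truncatedMoebius_apply (N n : ℕ) :
    truncatedMoebius N n = if n ≤ N then moebius n else 0 := rfl

/-- With f the truncation of μ, the relation μ * 1 = ε (the convolution identity) gives μ = 2f −
f*f*1 + (μ − f)*(μ − f)*1. Both factors μ − f vanish up to N, so the last term vanishes up to N². -/
theorem moebius_eq_of_le_sq {N k : ℕ} (hk : k ≤ N * N) :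
    moebius k = 2 * truncatedMoebius N k -
      (truncatedMoebius N * (truncatedMoebius N * (zeta : ArithmeticFunction ℤ))) k := by
  have h1 : moebius = truncatedMoebius N + truncatedMoebius N -
      truncatedMoebius N * (truncatedMoebius N * (zeta : ArithmeticFunction ℤ)) +
      ((moebius - truncatedMoebius N) * (moebius - truncatedMoebius N)) *
        (zeta : ArithmeticFunction ℤ) := by
    linear_combination (2 * truncatedMoebius N - moebius) * moebius_mul_coe_zeta
  have h2 : (((moebius - truncatedMoebius N) * (moebius - truncatedMoebius N)) *
        (zeta : ArithmeticFunction ℤ)) k = 0 := by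
    rw [mul_apply]
    refine Finset.sum_eq_zero fun x hx => ?_
    rw [mul_apply, Finset.sum_mul]
    refine Finset.sum_eq_zero fun y hy => ?_
    obtain ⟨hx1, hx0⟩ := Nat.mem_divisorsAntidiagonal.1 hx
    obtain ⟨hy1, hy0⟩ := Nat.mem_divisorsAntidiagonal.1 hy
    have hle : y.1 * y.2 ≤ N * N := by
      rw [hy1]
      refine le_trans ?_ hk
      rw [← hx1]
      exact Nat.le_mul_of_pos_right _ (Nat.pos_of_ne_zero fun h => hx0 (by rw [← hx1, h, mul_zero]))
    have hz : ∀ n, n ≤ N → (moebius - truncatedMoebius N) n = 0 := fun n hn => by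
      
      rw [sub_eq_add_neg, ArithmeticFunction.add_apply, ArithmeticFunction.neg_apply,
        truncatedMoebius_apply, if_pos hn, add_neg_cancel]
    rcases le_or_gt y.1 N with h | h
    · rw [hz _ h, zero_mul, zero_mul]
    · have : y.2 ≤ N := by
        by_contra! h'
        exact absurd hle (not_le.2 (Nat.mul_lt_mul'' h h'))
      rw [hz _ this, mul_zero, zero_mul]
  have h3 := congrArg (fun f : ArithmeticFunction ℤ => f k) h1
  rw [sub_eq_add_neg _ (truncatedMoebius N * _)] at h3
  simp only [ArithmeticFunction.add_apply, ArithmeticFunction.neg_apply] at h3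
  rw [h2] at h3
  rw [h3]
  ring

theorem sum_Ioc_truncatedMoebius {N X : ℕ} (h : N ≤ X) (f : ℕ → ℤ) :
    ∑ n ∈ Finset.Ioc 0 X, truncatedMoebius N n * f n = ∑ n ∈ Finset.Icc 1 N, moebius n * f n := by
  symm
  refine Finset.sum_subset_zero_on_sdiff ?_ ?_ ?_
  · intro n hn
    rw [Finset.mem_Icc] at hn
    rw [Finset.mem_Ioc]
    omega
  · intro n hn
    rw [Finset.mem_sdiff, Finset.mem_Ioc, Finset.mem_Icc] at hn
    rw [truncatedMoebius_apply, if_neg (by omega), zero_mul]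
  · intro n hn
    rw [truncatedMoebius_apply, if_pos (Finset.mem_Icc.1 hn).2]

/-- Meissel's identity. -/
theorem sum_moebius_sq (N : ℕ) :
    ∑ n ∈ Finset.Icc 1 (N * N), moebius n = 2 * ∑ n ∈ Finset.Icc 1 N, moebius n -
      ∑ m ∈ Finset.Icc 1 N, ∑ n ∈ Finset.Icc 1 N,
        moebius m * (moebius n * ((N * N / (m * n) : ℕ) : ℤ)) := by
  have hNN : N ≤ N * N := Nat.le_mul_self N
  have h1 : Finset.Icc 1 (N * N) = Finset.Ioc 0 (N * N) := rfl
  have h2 : ∑ n ∈ Finset.Icc 1 (N * N), moebius n = ∑ n ∈ Finset.Ioc 0 (N * N),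
      (2 * truncatedMoebius N n -
        (truncatedMoebius N * (truncatedMoebius N * (zeta : ArithmeticFunction ℤ))) n) := by
    rw [h1]
    refine Finset.sum_congr rfl fun n hn => ?_
    rw [Finset.mem_Ioc] at hn
    exact moebius_eq_of_le_sq hn.2
  have h3 : ∑ n ∈ Finset.Ioc 0 (N * N), truncatedMoebius N n = ∑ n ∈ Finset.Icc 1 N, moebius n := by
    simpa using sum_Ioc_truncatedMoebius hNN fun _ => 1
  rw [h2, Finset.sum_sub_distrib, ← Finset.mul_sum, h3, sum_Ioc_mul_eq_sum_sum,
    sum_Ioc_truncatedMoebius hNN]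
  congr 1
  refine Finset.sum_congr rfl fun m hm => ?_
  rw [Finset.mem_Icc] at hm
  -- Because m ≤ N, the inner summation range contains the whole support of the truncated function.
  have hNm : N ≤ N * N / m := by
    rw [Nat.le_div_iff_mul_le (by omega)]
    exact Nat.mul_le_mul_left N hm.2
  rw [sum_Ioc_mul_zeta_eq_sum, sum_Ioc_truncatedMoebius hNm (fun n => ((N * N / m / n : ℕ) : ℤ)),
    Finset.mul_sum]
  simp only [Nat.div_div_eq_div_mul]

theorem mertensKernel_gridPoint {N m n : ℕ} (hm : m ∈ Finset.Icc 1 N) (hn : n ∈ Finset.Icc 1 N) :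
    mertensKernel (gridPoint N m) (gridPoint N n) =
      1 / 2 - (N : ℝ) ^ 2 / (m * n) + ((N * N / (m * n) : ℕ) : ℝ) := by
  rw [Finset.mem_Icc] at hm hn
  have hN0 : (0 : ℝ) < N := by exact_mod_cast (by omega : 0 < N)
  have hm0 : (0 : ℝ) < m := by exact_mod_cast (by omega : 0 < m)
  have hn0 : (0 : ℝ) < n := by exact_mod_cast (by omega : 0 < n)
  rw [mertensKernel, coe_gridPoint hm.2, coe_gridPoint hn.2, if_pos ⟨by positivity, by positivity⟩]
  have h1 : 1 / ((m : ℝ) / N * ((n : ℝ) / N)) = ((N * N : ℕ) : ℝ) / ((m * n : ℕ) : ℝ) := by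
    push_cast
    field_simp
  have h2 : ((⌊((N * N : ℕ) : ℝ) / ((m * n : ℕ) : ℝ)⌋ : ℤ) : ℝ) = ((N * N / (m * n) : ℕ) : ℝ) := by
    rw [← natCast_floor_eq_intCast_floor (by positivity), Nat.floor_div_eq_div]
  rw [h1, Int.fract, h2]
  push_cast
  ring

theorem mertens_natCast (n : ℕ) :
    mertens (n : ℝ) = ∑ k ∈ Finset.Icc 1 n, (moebius k : ℝ) := by
  rw [mertens, Nat.floor_natCast]

/-- Solving the formula for K at grid points for the integer quotient and inserting it into
Meissel's identity; the parts 1/2 and N²/(mn) factor into squares of single sums. -/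
theorem mertens_sq_eq (N : ℕ) :
    mertens ((N : ℝ) ^ 2) = 2 * mertens N + mertens N ^ 2 / 2 -
      (∑ n ∈ Finset.Icc 1 N, (moebius n : ℝ) / n) ^ 2 * (N : ℝ) ^ 2 -
      ∑ m ∈ Finset.Icc 1 N, ∑ n ∈ Finset.Icc 1 N, (moebius m : ℝ) * ((moebius n : ℝ) *
        mertensKernel (gridPoint N m) (gridPoint N n)) := by
  have h1 := congrArg (fun z : ℤ => (z : ℝ)) (sum_moebius_sq N)
  simp only [Int.cast_sub, Int.cast_mul, Int.cast_sum, Int.cast_natCast, Int.cast_ofNat] at h1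
  have h2 : ∑ m ∈ Finset.Icc 1 N, ∑ n ∈ Finset.Icc 1 N, (moebius m : ℝ) * ((moebius n : ℝ) *
        mertensKernel (gridPoint N m) (gridPoint N n)) =
      mertens N ^ 2 / 2 - (∑ n ∈ Finset.Icc 1 N, (moebius n : ℝ) / n) ^ 2 * (N : ℝ) ^ 2 +
      ∑ m ∈ Finset.Icc 1 N, ∑ n ∈ Finset.Icc 1 N,
        (moebius m : ℝ) * ((moebius n : ℝ) * ((N * N / (m * n) : ℕ) : ℝ)) := by
    rw [mertens_natCast, pow_two (∑ n ∈ Finset.Icc 1 N, (moebius n : ℝ)),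
      pow_two (∑ n ∈ Finset.Icc 1 N, (moebius n : ℝ) / n), Finset.sum_mul_sum,
      Finset.sum_mul_sum, Finset.sum_div, Finset.sum_mul, ← Finset.sum_sub_distrib,
      ← Finset.sum_add_distrib]
    refine Finset.sum_congr rfl fun m hm => ?_
    rw [Finset.sum_div, Finset.sum_mul, ← Finset.sum_sub_distrib, ← Finset.sum_add_distrib]
    refine Finset.sum_congr rfl fun n hn => ?_
    rw [mertensKernel_gridPoint hm hn, mul_comm (m : ℝ), ← div_div]
    ring
  have h3 : mertens ((N : ℝ) ^ 2) = ∑ k ∈ Finset.Icc 1 (N * N), (moebius k : ℝ) := by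
    rw [← mertens_natCast]
    push_cast
    rw [pow_two]
  rw [h2, h3, h1, mertens_natCast]
  ring

end Meissel

/-! ### The Möbius step function and sampled eigenfunctions -/

/-- The step function on `[0,1]` with value `μ(n)` on `((n - 1) / N, n / N]`. -/
noncomputable def moebiusStep (N : ℕ) (x : unitInterval) : ℝ :=
  (ArithmeticFunction.moebius ⌈(N : ℝ) * x⌉₊ : ℝ)

theorem abs_moebius_le_one_real (n : ℕ) : |(ArithmeticFunction.moebius n : ℝ)| ≤ 1 := by
  exact_mod_cast ArithmeticFunction.abs_moebius_le_one (n := n)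

theorem abs_moebiusStep_le_one (N : ℕ) (x : unitInterval) : |moebiusStep N x| ≤ 1 :=
  abs_moebius_le_one_real _

theorem measurable_moebiusStep (N : ℕ) : Measurable (moebiusStep N) :=
  (measurable_from_nat (f := fun n => (ArithmeticFunction.moebius n : ℝ))).comp
    (measurable_ceil_mul N)

theorem memLp_moebiusStep (N : ℕ) : MemLp (moebiusStep N) 2 volume :=
  memLp_of_measurable_of_bound (measurable_moebiusStep N) (abs_moebiusStep_le_one N)

theorem integrable_moebiusStep (N : ℕ) : Integrable (moebiusStep N) volume :=
  (memLp_moebiusStep N).integrable one_le_two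

theorem isBoundedKernel_gridCeil_right (N : ℕ) :
    IsBoundedKernel (fun y x => mertensKernel (gridCeil N x) y) (1 / 2) :=
  (isBoundedKernel_gridCeil_left N).swap

/-- The error of the integral of the kernel against the Möbius step function that comes from
rounding up the variable of integration. -/
noncomputable def roundingError (N : ℕ) (y : unitInterval) : ℝ :=
  (∫ x, mertensKernel (gridCeil N x) y * moebiusStep N x) - ∫ x, mertensKernel y x * moebiusStep N x

theorem memLp_roundingError (N : ℕ) : MemLp (roundingError N) 2 volume :=
  ((isBoundedKernel_gridCeil_right N).memLp_integral (memLp_moebiusStep N)).sub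
    (isBoundedKernel_mertensKernel.memLp_integral (memLp_moebiusStep N))

theorem abs_roundingError_le {N : ℕ} (hN : 1 ≤ N) {y : unitInterval} (hy : 0 < (y : ℝ)) :
    |roundingError N y| ≤ roundingBound N y := by
  refine le_trans ?_ (integral_abs_mertensKernel_sub_le hN hy)
  rw [roundingError, ← integral_sub
    ((isBoundedKernel_gridCeil_right N).integrable_mul (integrable_moebiusStep N) y)
    (isBoundedKernel_mertensKernel.integrable_mul (integrable_moebiusStep N) y)]
  rw [← Real.norm_eq_abs]
  refine norm_integral_le_of_norm_le (integrable_of_measurable_of_bound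
    ((isBoundedKernel_abs_sub N).measurable_left y) fun x => (isBoundedKernel_abs_sub N).bound x y)
    (Filter.Eventually.of_forall fun x => ?_)
  rw [Real.norm_eq_abs, ← sub_mul, abs_mul, mertensKernel_comm y x]
  exact mul_le_of_le_one_right (abs_nonneg _) (abs_moebiusStep_le_one N x)

theorem integral_roundingError_sq_le {N : ℕ} (hN : 1 ≤ N) :
    ∫ y, roundingError N y ^ 2 ≤ (3 * gridError N) ^ 2 := by
  refine le_trans (integral_mono_ae (memLp_roundingError N).integrable_sq
    (memLp_roundingBound N).integrable_sq ?_) (integral_roundingBound_sq_le hN)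
  filter_upwards [ae_pos_unitInterval] with y hy
  exact sq_le_sq' (by linarith [neg_le_of_abs_le (abs_roundingError_le hN hy)])
    (le_of_abs_le (abs_roundingError_le hN hy))

theorem moebiusSum_eq {N : ℕ} (hN : 1 ≤ N) (φ : unitInterval → ℝ) :
    moebiusSum N φ = N * ∫ x, moebiusStep N x * φ (gridCeil N x) := by
  have hN0 : (N : ℝ) ≠ 0 := by exact_mod_cast (by omega : N ≠ 0)
  have h := integral_ceil_mul hN fun n =>
    (ArithmeticFunction.moebius n : ℝ) * φ (gridPoint N n)
  change ∫ x, moebiusStep N x * φ (gridCeil N x) = _ at h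
  rw [h, moebiusSum, ← mul_assoc, mul_one_div_cancel hN0, one_mul]

/-- The sampled sums over an eigenfunction are, up to the rounding error, inner products. -/
theorem mul_moebiusSum_eq {N : ℕ} (hN : 1 ≤ N) {ν : ℝ} (hν : ν ≠ 0) {φ : unitInterval → ℝ}
    (hφ : IsKernelEigenfunction mertensKernel (1 / ν) φ) :
    ν * (moebiusSum N φ / N) = ν * inner ℝ (hφ.memLp.toLp φ) ((memLp_moebiusStep N).toLp _) +
      inner ℝ (hφ.memLp.toLp φ) ((memLp_roundingError N).toLp _) := by
  have hN0 : (N : ℝ) ≠ 0 := by exact_mod_cast (by omega : N ≠ 0)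
  have hφ1 : Integrable φ volume := hφ.memLp.integrable one_le_two
  have hc := memLp_moebiusStep N
  have h1 : ν * (moebiusSum N φ / N) =
      ∫ y, φ y * ∫ x, mertensKernel (gridCeil N x) y * moebiusStep N x := by
    rw [moebiusSum_eq hN, mul_div_cancel_left₀ _ hN0, ← integral_const_mul]
    calc ∫ x, ν * (moebiusStep N x * φ (gridCeil N x))
        = ∫ x, ∫ y, mertensKernel (gridCeil N x) y * (moebiusStep N x * φ y) := by
          congr 1 with x
          -- The grid is a null set, so it matters that the eigenfunction equation holds at every
          -- point.
          rw [hφ.eq (gridCeil N x)]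
          have h : ν * (moebiusStep N x * (1 / ν * ∫ y, mertensKernel (gridCeil N x) y * φ y)) =
              moebiusStep N x * ∫ y, mertensKernel (gridCeil N x) y * φ y := by
            field_simp
          rw [h, ← integral_const_mul]
          congr 1 with y
          ring
      _ = ∫ y, ∫ x, mertensKernel (gridCeil N x) y * (moebiusStep N x * φ y) :=
          integral_integral_swap ((isBoundedKernel_gridCeil_left N).integrable_prod hφ1
            (integrable_moebiusStep N))
      _ = ∫ y, φ y * ∫ x, mertensKernel (gridCeil N x) y * moebiusStep N x := by
          congr 1 with y
          rw [← integral_const_mul]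
          congr 1 with x
          ring
  have h2 : ν * inner ℝ (hφ.memLp.toLp φ) (hc.toLp _) =
      ∫ y, φ y * ∫ x, mertensKernel y x * moebiusStep N x := by
    have hs := isSymmetric_kernelOp isBoundedKernel_mertensKernel mertensKernel_comm
      (hφ.memLp.toLp φ) (hc.toLp _)
    change inner ℝ (kernelOp _ _) _ = inner ℝ _ (kernelOp _ _) at hs
    rw [IsKernelEigenfunction.kernelOp_toLp isBoundedKernel_mertensKernel (one_div_ne_zero hν)
      hφ.memLp hφ.eq, one_div_one_div, real_inner_smul_left, kernelOp_toLp,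
      inner_toLp_toLp hφ.memLp (isBoundedKernel_mertensKernel.memLp_integral hc)] at hs
    exact hs
  have h3 : Integrable (fun y => φ y * ∫ x, mertensKernel y x * moebiusStep N x) volume :=
    hφ.memLp.integrable_mul (isBoundedKernel_mertensKernel.memLp_integral hc)
  have h4 : Integrable (fun y => φ y * roundingError N y) volume :=
    hφ.memLp.integrable_mul (memLp_roundingError N)
  rw [h1, h2, inner_toLp_toLp, ← integral_add h3 h4]
  congr 1 with y
  rw [roundingError]
  ring

theorem sum_moebius_mul_mertensKernel_eq {N : ℕ} (hN : 1 ≤ N) :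
    ∑ m ∈ Finset.Icc 1 N, ∑ n ∈ Finset.Icc 1 N, (ArithmeticFunction.moebius m : ℝ) *
      ((ArithmeticFunction.moebius n : ℝ) * mertensKernel (gridPoint N m) (gridPoint N n)) =
    N ^ 2 * ∫ y, moebiusStep N y *
      ∫ x, mertensKernel (gridCeil N x) (gridCeil N y) * moebiusStep N x := by
  have hN0 : (N : ℝ) ≠ 0 := by exact_mod_cast (by omega : N ≠ 0)
  have h1 := moebiusSum_eq hN fun y => ∫ x, mertensKernel (gridCeil N x) y * moebiusStep N x
  have h2 : ∀ y, N * ∫ x, mertensKernel (gridCeil N x) y * moebiusStep N x =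
      moebiusSum N fun x => mertensKernel x y := fun y => by
    rw [moebiusSum_eq hN]
    simp only [mul_comm]
  rw [pow_two, mul_assoc, ← h1, moebiusSum, Finset.mul_sum]
  refine Finset.sum_congr rfl fun m _ => ?_
  rw [mul_left_comm, h2, moebiusSum, Finset.mul_sum]
  refine Finset.sum_congr rfl fun n _ => ?_
  rw [mertensKernel_comm]

/-- The two arguments are rounded one at a time, each at a mean cost of at most 3 `gridError N`. -/
theorem abs_sum_moebius_sub_inner_le {N : ℕ} (hN : 1 ≤ N) :
    |(∫ y, moebiusStep N y *
      ∫ x, mertensKernel (gridCeil N x) (gridCeil N y) * moebiusStep N x) -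
      inner ℝ ((memLp_moebiusStep N).toLp _) (kernelOp isBoundedKernel_mertensKernel
        ((memLp_moebiusStep N).toLp _))| ≤ 6 * gridError N := by
  have hK := isBoundedKernel_mertensKernel
  have hc := memLp_moebiusStep N
  have hc1 := integrable_moebiusStep N
  have habs := isBoundedKernel_abs_sub N
  have hkk : IsBoundedKernel (fun y x => mertensKernel (gridCeil N x) (gridCeil N y)) (1 / 2) :=
    (isBoundedKernel_gridCeil_right N).comp_left (measurable_gridCeil N)
  have hrow : Integrable (fun y => ∫ x,
      |mertensKernel (gridCeil N y) x - mertensKernel y x|) volume :=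
    habs.integrable_uncurry.integral_prod_left
  have h3 : Integrable (fun y => moebiusStep N y *
      ∫ x, mertensKernel (gridCeil N x) (gridCeil N y) * moebiusStep N x) volume :=
    hc.integrable_mul (hkk.memLp_integral hc)
  have h4 : Integrable (fun y => moebiusStep N y *
      ∫ x, mertensKernel y x * moebiusStep N x) volume :=
    hc.integrable_mul (hK.memLp_integral hc)
  rw [kernelOp_toLp, inner_toLp_toLp, ← integral_sub h3 h4]
  have hbound : ∀ᵐ y : unitInterval, ‖moebiusStep N y *
        (∫ x, mertensKernel (gridCeil N x) (gridCeil N y) * moebiusStep N x) -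
        moebiusStep N y * ∫ x, mertensKernel y x * moebiusStep N x‖ ≤
      roundingBound N y + ∫ x, |mertensKernel (gridCeil N y) x - mertensKernel y x| := by
    filter_upwards [ae_pos_unitInterval] with y hy
    have hy' : 0 < (gridCeil N y : ℝ) := hy.trans_le (le_gridCeil hN y)
    -- The first rounding takes place at the rounded point; the bound is antitone in y, so it is no
    -- worse there than at y itself.
    have h1 := (abs_roundingError_le hN hy').trans (roundingBound_anti hN hy (le_gridCeil hN y))
    have h2 : |(∫ x, mertensKernel (gridCeil N y) x * moebiusStep N x) -
        ∫ x, mertensKernel y x * moebiusStep N x| ≤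
        ∫ x, |mertensKernel (gridCeil N y) x - mertensKernel y x| := by
      rw [← integral_sub (hK.integrable_mul hc1 _) (hK.integrable_mul hc1 y)]
      rw [← Real.norm_eq_abs]
      refine norm_integral_le_of_norm_le (integrable_of_measurable_of_bound
        (habs.measurable_right y) (habs.bound y)) (Filter.Eventually.of_forall fun x => ?_)
      rw [Real.norm_eq_abs, ← sub_mul, abs_mul]
      exact mul_le_of_le_one_right (abs_nonneg _) (abs_moebiusStep_le_one N x)
    rw [Real.norm_eq_abs, ← mul_sub, abs_mul]
    refine (mul_le_of_le_one_left (abs_nonneg _) (abs_moebiusStep_le_one N y)).trans ?_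
    refine (abs_sub_le _ (∫ x, mertensKernel (gridCeil N y) x * moebiusStep N x) _).trans ?_
    exact add_le_add h1 h2
  have hb := (memLp_roundingBound N).integrable one_le_two
  rw [← Real.norm_eq_abs]
  refine (norm_integral_le_of_norm_le (hb.add hrow) hbound).trans ?_
  simp only [Pi.add_apply]
  rw [integral_add hb hrow]
  linarith [integral_roundingBound_le hN, integral_integral_abs_sub_le hN]

/-- Perturbing the coefficients of a truncated eigenvector expansion. -/
theorem abs_sum_eigenvectors_perturb_le {E : Type*} [NormedAddCommGroup E]
    [InnerProductSpace ℝ E] {ι : Type*} [Fintype ι] {u : ι → E} (hu : Orthonormal ℝ u)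
    {ν s : ι → ℝ} {δ : ℝ} (hδ : 0 < δ) (hν : ∀ i, δ < |ν i|) {c e : E} (hc : ‖c‖ ^ 2 ≤ 1)
    (he : ‖e‖ ^ 2 ≤ (3 * δ) ^ 2)
    (hs : ∀ i, ν i * s i = ν i * inner ℝ (u i) c + inner ℝ (u i) e) :
    |∑ i, ν i * s i ^ 2 - ∑ i, ν i * inner ℝ (u i) c ^ 2| ≤ 19 * δ := by
  have hb1 : ∑ i, inner ℝ (u i) c ^ 2 ≤ 1 := by
    have h := hu.sum_inner_products_le c (s := Finset.univ)
    simp only [Real.norm_eq_abs, sq_abs] at h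
    exact h.trans hc
  have hb2 : ∑ i, inner ℝ (u i) e ^ 2 ≤ (3 * δ) ^ 2 := by
    have h := hu.sum_inner_products_le e (s := Finset.univ)
    simp only [Real.norm_eq_abs, sq_abs] at h
    exact h.trans he
  -- With s = p + ε/ν the difference is 2pε + ε²/ν. The weighted inequality |2pε| ≤ δp² + ε²/δ lets
  -- Bessel bound both sums: δ·1 + (2/δ)(3δ)² = 19δ.
  have hterm : ∀ i, |ν i * s i ^ 2 - ν i * inner ℝ (u i) c ^ 2| ≤
      δ * inner ℝ (u i) c ^ 2 + 2 / δ * inner ℝ (u i) e ^ 2 := by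
    intro i
    have hν0 : ν i ≠ 0 := fun h => by
      have := hν i
      rw [h, abs_zero] at this
      linarith
    have hsi := hs i
    generalize inner ℝ (u i) c = p at hsi ⊢
    generalize inner ℝ (u i) e = ε at hsi ⊢
    have hsi' : s i = p + ε / ν i := by
      field_simp
      linarith
    have heq : ν i * s i ^ 2 - ν i * p ^ 2 = 2 * p * ε + ε ^ 2 / ν i := by
      rw [hsi']
      field_simp
      ring
    have h1 : |ε ^ 2 / ν i| ≤ ε ^ 2 / δ := by
      rw [abs_div, abs_of_nonneg (sq_nonneg ε)]
      exact div_le_div_of_nonneg_left (sq_nonneg ε) hδ (hν i).le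
    have h2 : |2 * p * ε| ≤ δ * p ^ 2 + ε ^ 2 / δ := by
      have h3 : δ * p ^ 2 + ε ^ 2 / δ - 2 * p * ε = (δ * p - ε) ^ 2 / δ := by
        field_simp
        ring
      have h4 : δ * p ^ 2 + ε ^ 2 / δ + 2 * p * ε = (δ * p + ε) ^ 2 / δ := by
        field_simp
        ring
      have h5 : 0 ≤ (δ * p - ε) ^ 2 / δ := by positivity
      have h6 : 0 ≤ (δ * p + ε) ^ 2 / δ := by positivity
      rw [abs_le]
      constructor <;> linarith
    rw [heq]
    refine (abs_add_le _ _).trans ((add_le_add h2 h1).trans (le_of_eq ?_))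
    ring
  rw [← Finset.sum_sub_distrib]
  refine (Finset.abs_sum_le_sum_abs _ _).trans ((Finset.sum_le_sum fun i _ => hterm i).trans ?_)
  rw [Finset.sum_add_distrib, ← Finset.mul_sum, ← Finset.mul_sum]
  calc _ ≤ δ * 1 + 2 / δ * (3 * δ) ^ 2 := by gcongr
    _ = 19 * δ := by
        field_simp
        ring

/-! ### Assembling the spectral sum and the error terms -/

theorem kernelOp_neg {K : unitInterval → unitInterval → ℝ} {C : ℝ} (hK : IsBoundedKernel K C) :
    kernelOp hK.neg = -kernelOp hK := by
  ext1 f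
  change _ = -kernelOp hK f
  rw [kernelOp_apply, kernelOp_apply, ← MemLp.toLp_neg]
  refine MemLp.toLp_congr _ _ (Filter.Eventually.of_forall fun x => ?_)
  simp only [neg_mul, integral_neg, Pi.neg_apply]

theorem recipPosEigenvalue_nonneg (K : unitInterval → unitInterval → ℝ) (j : ℕ) :
    0 ≤ recipPosEigenvalue K j :=
  Real.sSup_nonneg fun _ ht => ht.1.le

theorem abs_mertens_natCast_le (N : ℕ) : |mertens (N : ℝ)| ≤ N := by
  rw [mertens_natCast]
  refine (Finset.abs_sum_le_sum_abs _ _).trans ?_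
  calc _ ≤ ∑ _k ∈ Finset.Icc 1 N, (1 : ℝ) := Finset.sum_le_sum fun k _ => abs_moebius_le_one_real k
    _ = N := by simp

/-- The orthonormal eigensystem of a kernel beyond the threshold `δ`, as vectors of `L²`. -/
theorem exists_eigenvectors {K : unitInterval → unitInterval → ℝ} {C : ℝ}
    (hK : IsBoundedKernel K C) (hs : ∀ x y, K x y = K y x) (hc : IsCompactOperator (kernelOp hK))
    {φp φm : ℕ → unitInterval → ℝ} (hφ : IsOrthonormalEigensystem K φp φm) {δ : ℝ} (hδ : 0 < δ) :
    ∃ n m : ℕ, (∀ j, δ < recipPosEigenvalue K j ↔ j < n) ∧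
      (∀ j, δ < |recipNegEigenvalue K j| ↔ j < m) ∧
      ∀ hp : ∀ j : Fin n, MemLp (φp j) 2 volume, ∀ hm : ∀ j : Fin m, MemLp (φm j) 2 volume,
        Orthonormal ℝ (Sum.elim (fun j => (hp j).toLp _) fun j => (hm j).toLp _) ∧
        ∀ μ : ℝ, δ < |μ| → ∀ v, kernelOp hK v = μ • v →
          (∀ j, inner ℝ ((hp j).toLp _) v = 0) → (∀ j, inner ℝ ((hm j).toLp _) v = 0) → v = 0 := by
  have hs' : ∀ x y, -K x y = -K y x := fun x y => by rw [hs]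
  have hn : ∀ j, δ < recipPosEigenvalue K j ↔ j < posCount hK hs hδ :=
    lt_recipPosEigenvalue_iff hK hs hδ
  have hmv : ∀ j, |recipNegEigenvalue K j| = recipPosEigenvalue (fun x y => -K x y) j := fun j => by
    rw [recipNegEigenvalue_eq, abs_neg, abs_of_nonneg (recipPosEigenvalue_nonneg _ j)]
  have hm : ∀ j, δ < |recipNegEigenvalue K j| ↔ j < posCount hK.neg hs' hδ := fun j => by
    rw [hmv]
    exact lt_recipPosEigenvalue_iff hK.neg hs' hδ j
  have hn0 : ∀ j : Fin (posCount hK hs hδ), recipPosEigenvalue K j ≠ 0 := fun j =>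
    (hδ.trans ((hn j).2 j.2)).ne'
  have hm0 : ∀ j : Fin (posCount hK.neg hs' hδ), recipNegEigenvalue K j ≠ 0 := fun j =>
    abs_pos.1 (hδ.trans ((hm j).2 j.2))
  refine ⟨_, _, hn, hm, fun hp hq => ?_⟩
  have hop : Orthonormal ℝ fun j => (hp j).toLp _ := by
    rw [orthonormal_iff_ite]
    intro i j
    rw [inner_toLp_toLp, hφ.orthonormal_pos i j (hn0 i) (hn0 j)]
    simp only [Fin.ext_iff]
  have hom : Orthonormal ℝ fun j => (hq j).toLp _ := by
    rw [orthonormal_iff_ite]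
    intro i j
    rw [inner_toLp_toLp, hφ.orthonormal_neg i j (hm0 i) (hm0 j)]
    simp only [Fin.ext_iff]
  have hx : ∀ i j, inner ℝ ((hp i).toLp _) ((hq j).toLp _) = 0 := fun i j => by
    rw [inner_toLp_toLp, hφ.orthogonal i j (hn0 i) (hm0 j)]
  refine ⟨⟨?_, ?_⟩, ?_⟩
  · rintro (i | i)
    · exact hop.1 i
    · exact hom.1 i
  · rintro (i | i) (j | j) hij
    · exact hop.2 fun h => hij (congrArg Sum.inl h)
    · exact hx i j
    · exact (real_inner_comm _ _).trans (hx j i)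
    · exact hom.2 fun h => hij (congrArg Sum.inr h)
  · intro μ hμ v hv hv1 hv2
    -- Eigenvectors with μ > δ are excluded by the positive family, those with −μ > δ by the
    -- negative family, viewed as the positive one of −K.
    rcases lt_abs.1 hμ with h | h
    · refine eq_zero_of_orthogonal_eigenvectors hK hs hc hδ hop (fun j => ?_) h hv hv1
      refine ⟨recipPosEigenvalue K j, (hn j).2 j.2, ?_⟩
      have he := hφ.eigen_pos j (hn0 j)
      rw [IsKernelEigenfunction.kernelOp_toLp hK (one_div_ne_zero (hn0 j)) (hp j) he.eq,
        one_div_one_div]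
    · refine eq_zero_of_orthogonal_eigenvectors hK.neg hs' (by rw [kernelOp_neg]; exact hc.neg) hδ
        hom (fun j => ?_) h (v := v) ?_ hv2
      · refine ⟨recipPosEigenvalue (fun x y => -K x y) j, by
          rw [← hmv]; exact (hm j).2 j.2, ?_⟩
        have he := hφ.eigen_neg j (hm0 j)
        rw [kernelOp_neg]
        change -kernelOp hK _ = _
        rw [IsKernelEigenfunction.kernelOp_toLp hK (one_div_ne_zero (hm0 j)) (hq j) he.eq,
          one_div_one_div, recipNegEigenvalue_eq, neg_smul, neg_neg]
      · rw [kernelOp_neg]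
        change -kernelOp hK v = _
        rw [hv, neg_smul]

/-- Of the 20δ, truncating the spectrum costs δ‖c‖² ≤ δ and replacing inner products by sampled sums
costs 19δ. -/
theorem abs_sum_eigenfunctions_sub_inner_le {φp φm : ℕ → unitInterval → ℝ}
    (hφ : IsOrthonormalEigensystem mertensKernel φp φm) {N : ℕ} (hN : 1 ≤ N) {δ : ℝ}
    (hδ0 : 0 < δ) (hδ : gridError N ≤ δ) :
    ∃ n m : ℕ, (∀ j, δ < recipPosEigenvalue mertensKernel j ↔ j < n) ∧
      (∀ j, δ < |recipNegEigenvalue mertensKernel j| ↔ j < m) ∧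
      |(∑ j ∈ Finset.range n,
          (moebiusSum N (φp j) / N) ^ 2 * recipPosEigenvalue mertensKernel j) -
        (∑ j ∈ Finset.range m,
          (moebiusSum N (φm j) / N) ^ 2 * |recipNegEigenvalue mertensKernel j|) -
        inner ℝ ((memLp_moebiusStep N).toLp _) (kernelOp isBoundedKernel_mertensKernel
          ((memLp_moebiusStep N).toLp _))| ≤ 20 * δ := by
  have hK := isBoundedKernel_mertensKernel
  obtain ⟨n, m, hn, hm, h⟩ := exists_eigenvectors hK mertensKernel_comm
    isCompactOperator_mertensKernel hφ hδ0
  refine ⟨n, m, hn, hm, ?_⟩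
  have hp : ∀ j : Fin n, IsKernelEigenfunction mertensKernel
      (1 / recipPosEigenvalue mertensKernel j) (φp j) := fun j =>
    hφ.eigen_pos j (hδ0.trans ((hn j).2 j.2)).ne'
  have hq : ∀ j : Fin m, IsKernelEigenfunction mertensKernel
      (1 / recipNegEigenvalue mertensKernel j) (φm j) := fun j =>
    hφ.eigen_neg j (abs_pos.1 (hδ0.trans ((hm j).2 j.2)))
  obtain ⟨hu, hcomp⟩ := h (fun j => (hp j).memLp) fun j => (hq j).memLp
  let ν : Fin n ⊕ Fin m → ℝ := Sum.elim (fun j => recipPosEigenvalue mertensKernel j)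
    fun j => recipNegEigenvalue mertensKernel j
  let s : Fin n ⊕ Fin m → ℝ := Sum.elim (fun j => moebiusSum N (φp j) / N)
    fun j => moebiusSum N (φm j) / N
  have hν : ∀ i, δ < |ν i| := by
    rintro (j | j)
    · exact ((hn j).2 j.2).trans_le (le_abs_self _)
    · exact (hm j).2 j.2
  have hν0 : ∀ i, ν i ≠ 0 := fun i => abs_pos.1 (hδ0.trans (hν i))
  have hT : ∀ i, kernelOp hK (Sum.elim (fun j => (hp j).memLp.toLp (φp j))
      (fun j => (hq j).memLp.toLp (φm j)) i) = ν i • Sum.elim (fun j => (hp j).memLp.toLp (φp j))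
      (fun j => (hq j).memLp.toLp (φm j)) i := by
    rintro (j | j)
    · have := IsKernelEigenfunction.kernelOp_toLp hK (one_div_ne_zero (hν0 (.inl j))) (hp j).memLp
        (hp j).eq
      rwa [one_div_one_div] at this
    · have := IsKernelEigenfunction.kernelOp_toLp hK (one_div_ne_zero (hν0 (.inr j))) (hq j).memLp
        (hq j).eq
      rwa [one_div_one_div] at this
  have hc : ‖(memLp_moebiusStep N).toLp _‖ ^ 2 ≤ 1 := by
    rw [norm_toLp_sq]
    calc ∫ x, moebiusStep N x ^ 2 ≤ ∫ _x : unitInterval, (1 : ℝ) :=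
          integral_mono (memLp_moebiusStep N).integrable_sq (integrable_const _) fun x =>
            (sq_le_one_iff_abs_le_one _).2 (abs_moebiusStep_le_one N x)
      _ = 1 := by simp
  have he : ‖(memLp_roundingError N).toLp _‖ ^ 2 ≤ (3 * δ) ^ 2 := by
    rw [norm_toLp_sq]
    refine (integral_roundingError_sq_le hN).trans ?_
    have := gridError_nonneg N
    gcongr
  have h1 := abs_sum_eigenvectors_perturb_le hu (ν := ν) (s := s) hδ0 hν hc he (by
    rintro (j | j)
    · exact mul_moebiusSum_eq hN (hν0 (.inl j)) (hp j)
    · exact mul_moebiusSum_eq hN (hν0 (.inr j)) (hq j))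
  have h2 := abs_inner_sub_sum_eigenvectors_le isCompactOperator_mertensKernel
    (isSymmetric_kernelOp hK mertensKernel_comm) hδ0.le hu hT
    (fun μ hμ v hv hv0 => hcomp μ hμ v hv (fun j => hv0 (.inl j)) fun j => hv0 (.inr j))
    ((memLp_moebiusStep N).toLp _)
  have h3 : ∑ i, ν i * s i ^ 2 =
      (∑ j ∈ Finset.range n,
        (moebiusSum N (φp j) / N) ^ 2 * recipPosEigenvalue mertensKernel j) -
      ∑ j ∈ Finset.range m,
        (moebiusSum N (φm j) / N) ^ 2 * |recipNegEigenvalue mertensKernel j| := by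
    rw [Fintype.sum_sum_type, Finset.sum_range, Finset.sum_range, sub_eq_add_neg,
      ← Finset.sum_neg_distrib]
    congr 1
    · exact Finset.sum_congr rfl fun j _ => mul_comm _ _
    · refine Finset.sum_congr rfl fun j _ => ?_
      have : recipNegEigenvalue mertensKernel j ≤ 0 := by
        rw [recipNegEigenvalue_eq]
        exact neg_nonpos.2 (recipPosEigenvalue_nonneg _ _)
      rw [abs_of_nonpos this]
      simp only [ν, s, Sum.elim_inr]
      ring
  rw [h3] at h1
  have h4 := h2.trans (mul_le_of_le_one_right hδ0.le hc)
  rw [abs_sub_comm] at h4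
  refine (abs_sub_le _ _ _).trans ((add_le_add h1 h4).trans (le_of_eq ?_))
  ring

theorem theorem3 :
    ∃ C : ℝ, ∀ φp φm : ℕ → unitInterval → ℝ,
      IsOrthonormalEigensystem mertensKernel φp φm →
      ∀ (N : ℕ) (δ : ℝ), 1 ≤ N → √((1 + Real.log (N : ℝ)) / (N : ℝ)) < δ →
        {j : ℕ | δ < |recipNegEigenvalue mertensKernel j|}.Finite ∧
        {j : ℕ | δ < recipPosEigenvalue mertensKernel j}.Finite ∧
        |mertens ((N : ℝ) ^ 2) -
          ((∑ᶠ j ∈ {j : ℕ | δ < |recipNegEigenvalue mertensKernel j|},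
              moebiusSum N (φm j) ^ 2 * |recipNegEigenvalue mertensKernel j|)
            - (∑ᶠ j ∈ {j : ℕ | δ < recipPosEigenvalue mertensKernel j},
              moebiusSum N (φp j) ^ 2 * recipPosEigenvalue mertensKernel j)
            + mertens (N : ℝ) ^ 2 / 2
            - (∑ n ∈ Finset.Icc 1 N, (ArithmeticFunction.moebius n : ℝ) / (n : ℝ)) ^ 2
              * (N : ℝ) ^ 2)|
          ≤ C * (δ * (N : ℝ) ^ 2) := by
  -- 28 = 20 + 6 + 2: spectral sum with sampling, rounding of the quadratic form, and the term
  -- 2M(N).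
  refine ⟨28, fun φp φm hφ N δ hN hδ => ?_⟩
  have hd : gridError N < δ := hδ
  have hδ0 : 0 < δ := (gridError_nonneg N).trans_lt hd
  have hN0 : (0 : ℝ) < N := by exact_mod_cast hN
  obtain ⟨n, m, hn, hm, h1⟩ := abs_sum_eigenfunctions_sub_inner_le hφ hN hδ0 hd.le
  have hsn : {j : ℕ | δ < recipPosEigenvalue mertensKernel j} = ↑(Finset.range n) := by
    ext j
    simpa using hn j
  have hsm : {j : ℕ | δ < |recipNegEigenvalue mertensKernel j|} = ↑(Finset.range m) := by
    ext j
    simpa using hm j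
  refine ⟨hsm ▸ Finset.finite_toSet _, hsn ▸ Finset.finite_toSet _, ?_⟩
  rw [hsm, hsn, finsum_mem_coe_finset, finsum_mem_coe_finset, mertens_sq_eq,
    sum_moebius_mul_mertensKernel_eq hN]
  have h2 := abs_sum_moebius_sub_inner_le hN
  have h3 : ∀ (k : ℕ) (f : ℕ → unitInterval → ℝ) (t : ℕ → ℝ),
      ∑ j ∈ Finset.range k, moebiusSum N (f j) ^ 2 * t j =
        N ^ 2 * ∑ j ∈ Finset.range k, (moebiusSum N (f j) / N) ^ 2 * t j := fun k f t => by
    rw [Finset.mul_sum]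
    refine Finset.sum_congr rfl fun j _ => ?_
    field_simp
  have h4 : |2 * mertens N| ≤ 2 * (δ * (N : ℝ) ^ 2) := by
    -- δ exceeds 1/N, so the trivial bound |M(N)| ≤ N suffices for the linear term.
    have h5 : (N : ℝ) ≤ δ * (N : ℝ) ^ 2 := by
      have h6 := (one_div_le_gridError hN).trans hd.le
      rw [div_le_iff₀ hN0] at h6
      nlinarith
    rw [abs_mul, abs_two]
    linarith [abs_mertens_natCast_le N]
  rw [h3 n φp, h3 m φm]
  generalize (∑ j ∈ Finset.range n,
    (moebiusSum N (φp j) / N) ^ 2 * recipPosEigenvalue mertensKernel j) = A at h1 ⊢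
  generalize (∑ j ∈ Finset.range m,
    (moebiusSum N (φm j) / N) ^ 2 * |recipNegEigenvalue mertensKernel j|) = B at h1 ⊢
  generalize inner ℝ ((memLp_moebiusStep N).toLp _) (kernelOp isBoundedKernel_mertensKernel
    ((memLp_moebiusStep N).toLp _)) = D at h1 h2
  generalize (∫ y, moebiusStep N y *
    ∫ x, mertensKernel (gridCeil N x) (gridCeil N y) * moebiusStep N x) = Q at h2 ⊢
  have h7 : |A - B - Q| ≤ 26 * δ := by
    have h8 := abs_sub_le (A - B) D Q
    rw [abs_sub_comm D Q] at h8
    linarith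
  have h9 : |(N : ℝ) ^ 2 * (A - B - Q)| ≤ 26 * (δ * (N : ℝ) ^ 2) := by
    rw [abs_mul, abs_of_pos (by positivity : (0 : ℝ) < (N : ℝ) ^ 2)]
    nlinarith [mul_le_mul_of_nonneg_left h7 (by positivity : (0 : ℝ) ≤ (N : ℝ) ^ 2)]
  rw [abs_le] at h4 h9 ⊢
  constructor <;> linarith [h4.1, h4.2, h9.1, h9.2]
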